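/- Let $\mathcal T$ be a unitary two-dimensional CFT with central charges $c_L=c_R=c>0$, a unique vacuum, a convergent torus partition function, and left- and right-moving $U(1)$ Kac--Moody currents $J,\bar J$ of level $k>0$. Label an orthonormal basis of simultaneous eigenstates of $L_0,\bar L_0,J_0,\bar J_0$ by $i$, with eigenvalues $h_i,\bar h_i,q_i,\bar q_i$, and put $\Delta_i=h_i+\bar h_i$. Assume: 1. $e^{2\pi i\nu}\mapsto e^{2\pi i\nu(J_0-\bar J_0)}$ is a faithful action of the compact group $U(1)$ (in particular all charges $q_i-\bar q_i$ are integers). 2. (Modular covariance.) For all $\beta>0$ and $\nu\in(-\tfrac12,\tfrac12]$, $$\sum_i e^{-\beta(\Delta_i-\frac c{12})}e^{2\pi i\nu(q_i-\bar q_i)}=\sum_i e^{-\frac{4\pi^2}{\beta}\left(\Delta_i-\frac c{12}+k\nu^2-\nu(q_i+\bar q_i)\right)},$$ the right side being the partition function of the defect Hilbert space of $g=e^{2\pi i\nu}$. 3. For the fixed integer charge $Q$ one has $N_0=1$, where $$N_0=\sum_{i}w(q_i)\,e^{-2\pi i q_iQ/k},$$ the sum running over the states with $\Delta_i=\frac{(q_i+\bar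 q_i)^2}{4k}$, $q_i=\bar q_i$ and $|q_i|\le\frac k2$, and $w(q)=1$ if $|q|<\frac k2$, $w(q)=\frac12$ if $|q|=\frac k2$. (This holds if the vacuum is the only such state.) Let $\frac1{2\delta}\int_{\Delta-\delta}^{\Delta+\delta}\rho_Q(\Delta')\,d\Delta'$ denote $\frac1{2\delta}$ times the number of states $i$ with $q_i-\bar q_i=Q$ and $\Delta_i\in[\Delta-\delta,\Delta+\delta]$. For a continuous integrable $\phi:\mathbb R\to\mathbb R$ write $\hat\phi(t)=\frac1{2\pi}\int\phi(x)e^{itx}\,dx$. Let $\delta>0$ and let $\phi_-\le\mathbf 1_{[-\delta,\delta]}\le\phi_+$, where $\phi_\pm$ are continuous and integrable and $\hat\phi_\pm$ are supported in $[-\Lambda,\Lambda]$ for some $\Lambda<2\pi$; put $c_\pm=\frac{2\pi}{2\delta}\hat\phi_\pm(0)$. Then, at leading order as $\Delta\to\infty$, $$c_-\sqrt{\frac{c}{48k\Delta^2}}\;e^{2\pi\sqrt{c\Delta/3}}\;\le\;\frac1{2\delta}\int_{\Delta-\delta}^{\Delta+\delta}\rho_Q(\Delta')\,d\Delta'\;\le\;c_+\sqrt{\frac{c}{48k\Delta^2}}\;e^{2\pi\sqrt{c\Delta/3}},$$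 meaning that for every $a<c_-$ (respectively every $a>c_+$) the lower (respectively upper) bound holds with $a$ in place of $c_-$ (respectively $c_+$) for all sufficiently large $\Delta$; the lower bound requires only $\phi_-$ and the upper bound only $\phi_+$. Moreover, for every $\delta>\frac12$ such $\phi_\pm$ exist with $c_->0$ and $c_+>0$. Consequently, for every $\delta>\frac12$ there are positive constants, depending only on $\delta$, with which in place of $c_\pm$ both inequalities hold exactly for all sufficiently large $\Delta$, for every such theory and charge $Q$. -/

import Mathlib

open Filter MeasureTheory

noncomputable section

/-- One chirality of the symmetry algebra of a unitary CFT with a `U(1)` current of level `k`: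
a Virasoro algebra of central charge `c` and a `U(1)` Kac--Moody algebra of level `k`, acting on
the space `H` of finite-energy states with `L_n† = L_{-n}` and `J_n† = J_{-n}`. -/
structure IsUnitaryCurrentAlgebra {H : Type*} [NormedAddCommGroup H] [InnerProductSpace ℂ H]
    (c k : ℝ) (L J : ℤ → Module.End ℂ H) : Prop where
  virasoro : ∀ m n : ℤ, L m * L n - L n * L m =
    ((m : ℂ) - n) • L (m + n) +
      (if m + n = 0 then ((c / 12 : ℝ) : ℂ) * ((m : ℂ) ^ 3 - m) else 0) • (1 : Module.End ℂ H)
  virasoro_current : ∀ m n : ℤ, L m * J n - J n * L m = (-(n : ℂ)) • J (m + n)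
  current : ∀ m n : ℤ, J m * J n - J n * J m =
    (if m + n = 0 then (k : ℂ) * (m : ℂ) else 0) • (1 : Module.End ℂ H)
  virasoro_adjoint : ∀ (n : ℤ) (x y : H), inner ℂ (L n x) y = inner ℂ x (L (-n) y)
  current_adjoint : ∀ (n : ℤ) (x y : H), inner ℂ (J n x) y = inner ℂ x (J (-n) y)

/-- The state space on the circle of a unitary 2d CFT with central charges `c_L = c_R = c` and left-
and right-moving `U(1)` currents of level `k`.  `H` is the space of finite-energy states, and
`state` is an orthonormal basis of it which diagonalises `L_0`, `L̄_0`, `J_0`, `J̄_0`, with eigenvalues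
`h`, `hbar`, `q`, `qbar`.  The torus partition function converges, and the vacuum (the state with
`h = hbar = 0`) exists and is unique. -/
structure UnitaryU1CFT (H : Type*) [NormedAddCommGroup H] [InnerProductSpace ℂ H]
    (ι : Type*) where
  c : ℝ
  k : ℝ
  c_pos : 0 < c
  k_pos : 0 < k
  L : ℤ → Module.End ℂ H
  Lbar : ℤ → Module.End ℂ H
  J : ℤ → Module.End ℂ H
  Jbar : ℤ → Module.End ℂ H
  left : IsUnitaryCurrentAlgebra c k L J
  right : IsUnitaryCurrentAlgebra c k Lbar Jbar
  comm_LL : ∀ m n : ℤ, Commute (L m) (Lbar n)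
  comm_LJ : ∀ m n : ℤ, Commute (L m) (Jbar n)
  comm_JL : ∀ m n : ℤ, Commute (J m) (Lbar n)
  comm_JJ : ∀ m n : ℤ, Commute (J m) (Jbar n)
  state : Module.Basis ι ℂ H
  orthonormal_state : Orthonormal ℂ state
  h : ι → ℝ
  hbar : ι → ℝ
  q : ι → ℝ
  qbar : ι → ℝ
  L_zero_state : ∀ i, L 0 (state i) = (h i : ℂ) • state i
  Lbar_zero_state : ∀ i, Lbar 0 (state i) = (hbar i : ℂ) • state i
  J_zero_state : ∀ i, J 0 (state i) = (q i : ℂ) • state i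
  Jbar_zero_state : ∀ i, Jbar 0 (state i) = (qbar i : ℂ) • state i
  summable_boltzmann : ∀ β : ℝ, 0 < β → Summable fun i => Real.exp (-β * (h i + hbar i))
  vacuum : ∃! i, h i = 0 ∧ hbar i = 0

namespace UnitaryU1CFT

variable {H : Type*} [NormedAddCommGroup H] [InnerProductSpace ℂ H] {ι : Type*}

/-- The scaling dimension of a state. -/
def dim (T : UnitaryU1CFT H ι) (i : ι) : ℝ := T.h i + T.hbar i

/-- The charge of a state under the generator `J_0 - J̄_0` of the `U(1)` symmetry. -/
def charge (T : UnitaryU1CFT H ι) (i : ι) : ℝ := T.q i - T.qbar i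

/-- The group element `g = exp (2π i ν)` of `U(1)` is represented by `exp (2π i ν (J_0 - J̄_0))`:
this is a well-defined (all charges are integers) and faithful action of `U(1)`. -/
def IsFaithfulCompact (T : UnitaryU1CFT H ι) : Prop :=
  (∀ i, ∃ n : ℤ, T.charge i = n) ∧
  ∀ ν ∈ Set.Ioc (-(1 / 2) : ℝ) (1 / 2),
    (∀ i, Complex.exp (2 * Real.pi * Complex.I * ν * T.charge i) = 1) → ν = 0

/-- The torus partition function with the symmetry line `g = exp (2π i ν)` along space:
`Tr_H (g e^{-β (L_0 + L̄_0 - c/12)})`. -/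
def twistedZ (T : UnitaryU1CFT H ι) (β ν : ℝ) : ℂ :=
  ∑' i, Complex.exp (-β * (T.dim i - T.c / 12)) *
    Complex.exp (2 * Real.pi * Complex.I * ν * T.charge i)

/-- The scaling dimensions in the defect Hilbert space of `g = exp (2π i ν)`.  It is the spectral
flow of the untwisted one, by `L_0 ↦ L_0 - ν J_0 + k ν² / 2` and `L̄_0 ↦ L̄_0 - ν J̄_0 + k ν² / 2`. -/
def defectDim (T : UnitaryU1CFT H ι) (ν : ℝ) (i : ι) : ℝ :=
  (T.h i - ν * T.q i + T.k * ν ^ 2 / 2) + (T.hbar i - ν * T.qbar i + T.k * ν ^ 2 / 2)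

/-- The torus partition function with the symmetry line `g = exp (2π i ν)` along time. -/
def defectZ (T : UnitaryU1CFT H ι) (β ν : ℝ) : ℂ :=
  ∑' i, Complex.exp (-β * (T.defectDim ν i - T.c / 12))

/-- The modular `S` transformation of the torus exchanges the two placements of the symmetry line. -/
def IsModularCovariant (T : UnitaryU1CFT H ι) : Prop :=
  ∀ β : ℝ, 0 < β → ∀ ν ∈ Set.Ioc (-(1 / 2) : ℝ) (1 / 2),
    T.twistedZ β ν = T.defectZ (4 * Real.pi ^ 2 / β) ν

/-- The states which contribute to the charge-`Q` partition function at leading order as `β → 0`: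
`Δ̂ = Δ - (q + q̄)² / (4k)` vanishes, `q = q̄` and `|q| ≤ k/2`. -/
def IsLeading (T : UnitaryU1CFT H ι) (i : ι) : Prop :=
  T.dim i - (T.q i + T.qbar i) ^ 2 / (4 * T.k) = 0 ∧ T.q i = T.qbar i ∧ |T.q i| ≤ T.k / 2

open Classical in
/-- `N_0 = ∑ w(q) e^{-2π i q Q / k}`, the sum over the leading states, with `w(q) = 1` for
`|q| < k/2` and `w(q) = 1/2` for `|q| = k/2`. -/
def leadingCoeff (T : UnitaryU1CFT H ι) (Q : ℤ) : ℂ :=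
  ∑ᶠ (i : ι) (_ : T.IsLeading i),
    (if |T.q i| < T.k / 2 then 1 else 1 / 2) *
      Complex.exp (-(2 * Real.pi * Complex.I * T.q i * Q / T.k))

/-- `(1 / 2δ) ∫_{Δ-δ}^{Δ+δ} ρ_Q(Δ') dΔ'`: the number of states of charge `Q` with dimension in
`[Δ-δ, Δ+δ]`, divided by the width of the window. -/
def avgDensity (T : UnitaryU1CFT H ι) (Q : ℤ) (δ Δ : ℝ) : ℝ :=
  1 / (2 * δ) *
    ({i | T.charge i = Q ∧ T.dim i ∈ Set.Icc (Δ - δ) (Δ + δ)}.ncard : ℝ)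

/-- `√(c / (48 k Δ²)) exp (2π √(c Δ / 3))`. -/
def cardyU1 (T : UnitaryU1CFT H ι) (Δ : ℝ) : ℝ :=
  Real.sqrt (T.c / (48 * T.k * Δ ^ 2)) * Real.exp (2 * Real.pi * Real.sqrt (T.c * Δ / 3))

end UnitaryU1CFT

/-- The Fourier transform `φ̂` normalised by `φ(x) = ∫ φ̂(t) e^{-i x t} dt`. -/
def bandFourier (φ : ℝ → ℝ) (t : ℝ) : ℂ :=
  1 / (2 * Real.pi) * ∫ x : ℝ, (φ x : ℂ) * Complex.exp (Complex.I * t * x)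

/-- `φ` is a continuous integrable function whose Fourier transform is supported in `[-Λ, Λ]`. -/
structure IsBandlimited (Λ : ℝ) (φ : ℝ → ℝ) : Prop where
  continuous : Continuous φ
  integrable : Integrable φ
  support : ∀ t : ℝ, Λ < |t| → bandFourier φ t = 0

/-- `φ` is a bandlimited minorant of the characteristic function of `[-δ, δ]`. -/
def IsWindowMinorant (Λ δ : ℝ) (φ : ℝ → ℝ) : Prop :=
  IsBandlimited Λ φ ∧ ∀ x, φ x ≤ Set.indicator (Set.Icc (-δ) δ) (fun _ => (1 : ℝ)) x

/-- `φ` is a bandlimited majorant of the characteristic function of `[-δ, δ]`. -/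
def IsWindowMajorant (Λ δ : ℝ) (φ : ℝ → ℝ) : Prop :=
  IsBandlimited Λ φ ∧ ∀ x, Set.indicator (Set.Icc (-δ) δ) (fun _ => (1 : ℝ)) x ≤ φ x

/-- The constant `(2π / 2δ) φ̂(0)` (`φ̂(0)` is real because `φ` is). -/
def windowConst (δ : ℝ) (φ : ℝ → ℝ) : ℝ := 2 * Real.pi / (2 * δ) * (bandFourier φ 0).re

end

/-! The count is a Tauberian estimate for the charge-`Q` partition function `Z_Q(z)`. Write `A =
π²c/3`. Integrating modular covariance against `e^{-2πiνQ}` isolates charge `Q` on one side. On the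
other side each state contributes an integral over `ν` of `e^{-w E(ν)}`, with `w = 4π²/z`, and
completing the square gives `E(ν) = Δ̂ + k(ν - x)²` with `x = (q + q̄)/2k`. Unitarity (the Sugawara
bound for both chiralities) gives `Δ̂ ≥ (q - q̄)²/4k ≥ 0`. As `Re w → ∞` only states with `Δ̂ = 0`
and `|x| ≤ 1/2` survive, each as a narrow Gaussian of mass `√(π/(k Re w))`, halved if its centre is
an endpoint of the window. Their sum is `N_0`.

A bandlimited minorant or majorant of the window turns the count into `∫ φ̂(t) e^{itΔ} Z_Q(β + it)
dt`, up to a factor `e^{±βδ}` that tends to 1. At `Δ = A/β²`, with `t = β^{3/2}u`, the vacuum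
exponent becomes exactly `-Au²/(1 + i√β u)`, so the limit `β → 0` is a Gaussian integral
(`tendsto_windowSum`).

The limit needs domination (`exists_norm_saddleIntegrand_le`). For `|t| ≤ β` the dual channel is
`O(1/√Re w)`. For `β ≤ |t| ≤ Λ` the partition function is bounded by positive charge-zero
quantities, where modular covariance can be applied a second time (`exists_norm_chargeZ_le`). The
resulting exponent, about `(c/12)t²/β`, stays below `A/β = (c/12)4π²/β` precisely because `Λ < 2π`.

Positive constants for `δ > 1/2` come from a Fejér kernel above and, below, from a function of type
`π/a` with `1/2 < a < δ`. -/

open Filter MeasureTheory Topology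

noncomputable section

/-! ### The Sugawara bound from unitarity. -/

/-- A lowest-weight vector of the current algebra satisfies the Sugawara bound `q² ≤ 2 k h`. -/
theorem IsUnitaryCurrentAlgebra.sq_charge_le_of_lowestWeight {H : Type*} [NormedAddCommGroup H]
    [InnerProductSpace ℂ H] {c k : ℝ} {L J : ℤ → Module.End ℂ H}
    (hA : IsUnitaryCurrentAlgebra c k L J) (hk : 0 < k) {v : H} (hv : v ≠ 0) {h q : ℝ}
    (hL0 : L 0 v = (h : ℂ) • v) (hJ0 : J 0 v = (q : ℂ) • v) (hL1 : L 1 v = 0) (hJ1 : J 1 v = 0) :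
    q ^ 2 ≤ 2 * k * h := by
  have e1 : L 1 (L (-1) v) = ((2 * h : ℝ) : ℂ) • v := by
    have := congrArg (fun f : Module.End ℂ H => f v) (hA.virasoro 1 (-1))
    simp only [LinearMap.sub_apply, LinearMap.add_apply, LinearMap.smul_apply, Module.End.mul_apply,
      hL1, hL0, smul_smul, map_zero, sub_zero, add_neg_cancel] at this
    rw [this]; push_cast; simp only [← add_smul, Module.End.one_apply]
    congr 1; ring
  have e2 : J 1 (J (-1) v) = (k : ℂ) • v := by
    have := congrArg (fun f : Module.End ℂ H => f v) (hA.current 1 (-1))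
    simpa [Module.End.mul_apply, hJ1] using this
  have e3 : L 1 (J (-1) v) = (q : ℂ) • v := by
    have := congrArg (fun f : Module.End ℂ H => f v) (hA.virasoro_current 1 (-1))
    simpa [Module.End.mul_apply, hL1, hJ0] using this
  have e4 : J 1 (L (-1) v) = (q : ℂ) • v := by
    have := congrArg (fun f : Module.End ℂ H => f v) (hA.virasoro_current (-1) 1)
    simp [Module.End.mul_apply, hJ1, hJ0] at this
    exact this
  -- Up to the factor `k`, this is the component of `L_{-1} v` orthogonal to `J_{-1} v`. Its squared
  -- norm is `k(2kh - q²)‖v‖²`, so positivity of the level-one Gram matrix is all that is used.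
  set w : H := (k : ℂ) • L (-1) v - (q : ℂ) • J (-1) v with hw
  have hL : ∀ y, inner ℂ (L (-1) v) y = inner ℂ v (L 1 y) := fun y => by
    simpa using hA.virasoro_adjoint (-1) v y
  have hJ : ∀ y, inner ℂ (J (-1) v) y = inner ℂ v (J 1 y) := fun y => by
    simpa using hA.current_adjoint (-1) v y
  have hww : inner ℂ w w = ((k * (2 * k * h - q ^ 2) : ℝ) : ℂ) * inner ℂ v v := by
    rw [hw]
    simp only [inner_sub_left, inner_sub_right, inner_smul_left, inner_smul_right, hL, hJ, e1, e2,
      e3, e4, Complex.conj_ofReal]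
    push_cast; ring
  have h1 : (0 : ℝ) ≤ (inner ℂ w w : ℂ).re := inner_self_nonneg (𝕜 := ℂ)
  have h2 : 0 < (inner ℂ v v : ℂ).re := by
    have := (inner_self_eq_norm_sq (𝕜 := ℂ) v)
    simp only [RCLike.re_to_complex] at this
    rw [this]; positivity
  rw [hww, Complex.re_ofReal_mul] at h1
  have h3 := nonneg_of_mul_nonneg_left h1 h2
  nlinarith [nonneg_of_mul_nonneg_right h3 hk]

/-- Matrix elements of an operator which shifts the eigenvalue of a symmetric operator. -/
theorem inner_eq_zero_of_shift {H : Type*} [NormedAddCommGroup H] [InnerProductSpace ℂ H]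
    {M X : Module.End ℂ H} (hM : ∀ x y, inner ℂ (M x) y = inner ℂ x (M y)) {s a b : ℝ} {v w : H}
    (hMX : M (X v) - X (M v) = (s : ℂ) • X v) (hv : M v = (a : ℂ) • v) (hw : M w = (b : ℂ) • w)
    (hne : b ≠ a + s) : inner ℂ w (X v) = 0 := by
  have h1 : M (X v) = ((a + s : ℝ) : ℂ) • X v := by
    rw [hv, map_smul, sub_eq_iff_eq_add] at hMX
    rw [hMX, ← add_smul]; push_cast; rw [add_comm]
  have h2 := hM w (X v)
  rw [h1, hw, inner_smul_left, inner_smul_right, Complex.conj_ofReal] at h2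
  have h3 : ((b : ℂ) - ((a + s : ℝ) : ℂ)) * inner ℂ w (X v) = 0 := by rw [sub_mul, h2, sub_self]
  refine (mul_eq_zero.mp h3).resolve_left ?_
  rw [← Complex.ofReal_sub]
  exact Complex.ofReal_ne_zero.mpr (sub_ne_zero.mpr hne)

/-- The Sugawara bound `q² ≤ 2 k h` in a unitary representation of a current algebra in which a
commuting symmetric operator `M` makes the joint spectrum bounded below and discrete. -/
theorem IsUnitaryCurrentAlgebra.sq_charge_le {H ι : Type*} [NormedAddCommGroup H]
    [InnerProductSpace ℂ H] {c k : ℝ} {L J : ℤ → Module.End ℂ H}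
    (hA : IsUnitaryCurrentAlgebra c k L J) (hk : 0 < k) (b : Module.Basis ι ℂ H)
    {M : Module.End ℂ H} (hM : ∀ x y, inner ℂ (M x) y = inner ℂ x (M y))
    (hLM : Commute (L 1) M) (hJM : Commute (J 1) M) {h q m : ι → ℝ}
    (hL0 : ∀ i, L 0 (b i) = (h i : ℂ) • b i) (hJ0 : ∀ i, J 0 (b i) = (q i : ℂ) • b i)
    (hMb : ∀ i, M (b i) = (m i : ℂ) • b i) (hfin : ∀ E, {i | h i + m i ≤ E}.Finite) (i : ι) :
    q i ^ 2 ≤ 2 * k * h i := by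
  -- A state of least `h` with the same `q` and `m` replaces the lowest-weight vector. It need not
  -- lie in the representation generated by `b i`: having `h j ≤ h i` and the same charge is enough.
  set S : Set ι := {j | h j ≤ h i ∧ q j = q i ∧ m j = m i} with hS
  have hSf : S.Finite := (hfin (h i + m i)).subset (by
    rintro j ⟨h1, -, h3⟩
    simp only [Set.mem_ofPred_eq]; linarith)
  obtain ⟨j, hjS, hj⟩ := Set.exists_min_image S h hSf ⟨i, le_rfl, rfl, rfl⟩
  have hL0s : ∀ x y, inner ℂ (L 0 x) y = inner ℂ x (L 0 y) := fun x y => by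
    simpa using hA.virasoro_adjoint 0 x y
  have hJ0s : ∀ x y, inner ℂ (J 0 x) y = inner ℂ x (J 0 y) := fun x y => by
    simpa using hA.current_adjoint 0 x y
  -- An operator lowering `L_0` by one and commuting with `J_0` and `M` could only map `b j` to
  -- states of `S` with smaller `h`, and there are none. This applies to both `L_1` and `J_1`.
  have key : ∀ X : Module.End ℂ H, L 0 * X - X * L 0 = (-1 : ℂ) • X → J 0 * X - X * J 0 = 0 →
      Commute X M → X (b j) = 0 := by
    intro X h1 h2 h3
    refine InnerProductSpace.ext_inner_left_basis b fun l => ?_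
    rw [inner_zero_right]
    by_contra hne
    have a1 : h l = h j + (-1) := by
      by_contra hc
      refine hne (inner_eq_zero_of_shift hL0s (s := -1) ?_ (hL0 j) (hL0 l) hc)
      simpa using congrArg (fun f : Module.End ℂ H => f (b j)) h1
    have a2 : q l = q j + 0 := by
      by_contra hc
      refine hne (inner_eq_zero_of_shift hJ0s (s := 0) ?_ (hJ0 j) (hJ0 l) hc)
      simpa using congrArg (fun f : Module.End ℂ H => f (b j)) h2
    have a3 : m l = m j + 0 := by
      by_contra hc
      refine hne (inner_eq_zero_of_shift hM (s := 0) ?_ (hMb j) (hMb l) hc)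
      have := congrArg (fun f : Module.End ℂ H => f (b j)) h3.eq
      simp only [Module.End.mul_apply] at this
      simp [this]
    have hl : l ∈ S := ⟨by linarith [hjS.1], by linarith [hjS.2.1], by linarith [hjS.2.2]⟩
    linarith [hj l hl]
  have hL1 : L 1 (b j) = 0 := key _ (by simpa using hA.virasoro 0 1)
    (by simpa [sub_eq_zero, eq_comm] using hA.virasoro_current 1 0) hLM
  have hJ1 : J 1 (b j) = 0 := key _ (by simpa using hA.virasoro_current 0 1)
    (by simpa using hA.current 0 1) hJM
  have := hA.sq_charge_le_of_lowestWeight hk (b.ne_zero j) (hL0 j) (hJ0 j) hL1 hJ1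
  rw [hjS.2.1] at this
  nlinarith [hjS.1]

/-! ### Lower bounds on the defect spectrum. -/

namespace UnitaryU1CFT

variable {H : Type*} [NormedAddCommGroup H] [InnerProductSpace ℂ H] {ι : Type*}

theorem finite_dim_le (T : UnitaryU1CFT H ι) (E : ℝ) : {i | T.dim i ≤ E}.Finite := by
  have h := (T.summable_boltzmann 1 one_pos).tendsto_cofinite_zero.eventually
    (gt_mem_nhds (Real.exp_pos (-E)))
  rw [eventually_cofinite] at h
  refine h.subset fun i hi => ?_
  simp only [Set.mem_ofPred_eq, not_lt] at hi ⊢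
  rw [Real.exp_le_exp]
  simp only [dim] at hi
  linarith

/-- Convergence of the partition function makes only `h + h̄` discrete, so `L̄_0` serves as the
commuting operator whose eigenvalue is held fixed while `h` is minimised. -/
theorem sq_q_le (T : UnitaryU1CFT H ι) (i : ι) : T.q i ^ 2 ≤ 2 * T.k * T.h i :=
  T.left.sq_charge_le T.k_pos T.state (M := T.Lbar 0)
    (fun x y => by simpa using T.right.virasoro_adjoint 0 x y) (T.comm_LL 1 0) (T.comm_JL 1 0)
    T.L_zero_state T.J_zero_state T.Lbar_zero_state (fun E => T.finite_dim_le E) i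

theorem sq_qbar_le (T : UnitaryU1CFT H ι) (i : ι) : T.qbar i ^ 2 ≤ 2 * T.k * T.hbar i :=
  T.right.sq_charge_le T.k_pos T.state (M := T.L 0)
    (fun x y => by simpa using T.left.virasoro_adjoint 0 x y) (T.comm_LL 0 1).symm
    (T.comm_LJ 0 1).symm T.Lbar_zero_state T.Jbar_zero_state T.L_zero_state
    (fun E => by simpa only [dim, add_comm] using T.finite_dim_le E) i

/-- `Δ̂ = Δ - (q + q̄)² / (4k)`. -/
def reducedDim (T : UnitaryU1CFT H ι) (i : ι) : ℝ :=
  T.dim i - (T.q i + T.qbar i) ^ 2 / (4 * T.k)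

/-- The holonomy `(q + q̄) / (2k)` at which the defect dimension of a state is smallest. -/
def flow (T : UnitaryU1CFT H ι) (i : ι) : ℝ := (T.q i + T.qbar i) / (2 * T.k)

/-- The two Sugawara bounds add up to `Δ ≥ (q² + q̄²)/2k = ((q + q̄)² + (q - q̄)²)/4k`. In
particular `Δ̂ = 0` forces `q = q̄`. -/
theorem sq_sub_le_reducedDim (T : UnitaryU1CFT H ι) (i : ι) :
    (T.q i - T.qbar i) ^ 2 / (4 * T.k) ≤ T.reducedDim i := by
  have hk := T.k_pos
  rw [reducedDim, le_sub_iff_add_le, ← add_div, div_le_iff₀ (by positivity), dim]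
  nlinarith [T.sq_q_le i, T.sq_qbar_le i]

theorem reducedDim_nonneg (T : UnitaryU1CFT H ι) (i : ι) : 0 ≤ T.reducedDim i :=
  le_trans (by have := T.k_pos; positivity) (T.sq_sub_le_reducedDim i)

theorem dim_nonneg (T : UnitaryU1CFT H ι) (i : ι) : 0 ≤ T.dim i := by
  have h := T.reducedDim_nonneg i
  have : 0 ≤ (T.q i + T.qbar i) ^ 2 / (4 * T.k) := by have := T.k_pos; positivity
  rw [reducedDim] at h; linarith

theorem isLeading_iff (T : UnitaryU1CFT H ι) (i : ι) :
    T.IsLeading i ↔ T.reducedDim i = 0 ∧ |T.flow i| ≤ 1 / 2 := by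
  have hk := T.k_pos
  have hq : T.reducedDim i = 0 → T.q i = T.qbar i := fun h => by
    have h1 := T.sq_sub_le_reducedDim i
    rw [h, div_le_iff₀ (by positivity), zero_mul] at h1
    exact sub_eq_zero.mp (pow_eq_zero_iff two_ne_zero |>.mp (le_antisymm h1 (sq_nonneg _)))
  have hf : T.q i = T.qbar i → T.flow i = T.q i / T.k := fun h => by
    rw [flow, ← h]; field_simp; ring
  have ha : |T.q i / T.k| ≤ 1 / 2 ↔ |T.q i| ≤ T.k / 2 := by
    rw [abs_div, abs_of_pos hk, div_le_iff₀ hk]; constructor <;> intro h <;> linarith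
  rw [IsLeading, ← reducedDim]
  constructor
  · rintro ⟨h1, h2, h3⟩
    exact ⟨h1, by rw [hf h2]; exact ha.mpr h3⟩
  · rintro ⟨h1, h2⟩
    exact ⟨h1, hq h1, by rw [hf (hq h1)] at h2; exact ha.mp h2⟩

theorem IsLeading.flow_eq {T : UnitaryU1CFT H ι} {i : ι} (h : T.IsLeading i) :
    T.flow i = T.q i / T.k := by
  have hk := T.k_pos
  rw [flow, ← h.2.1]; field_simp; ring

/-- Completing the square in `ν`; this exposes each state as a Gaussian in the holonomy. -/
theorem defectDim_eq (T : UnitaryU1CFT H ι) (ν : ℝ) (i : ι) :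
    T.defectDim ν i = T.reducedDim i + T.k * (ν - T.flow i) ^ 2 := by
  have hk := T.k_pos
  rw [defectDim, reducedDim, flow, dim]; field_simp; ring

theorem defectDim_nonneg (T : UnitaryU1CFT H ι) (ν : ℝ) (i : ι) : 0 ≤ T.defectDim ν i := by
  rw [defectDim_eq]
  have := T.reducedDim_nonneg i
  have := T.k_pos
  positivity

/-- The cross term satisfies `2kνx ≤ kx²/2 + 2kν²` with `x` the flow, and `kx² ≤ Δ` since `Δ̂ ≥ 0`.
The bound is uniform over the window, so sums over the defect spectrum are dominated by the
untwisted partition function. -/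
theorem le_defectDim (T : UnitaryU1CFT H ι) {ν : ℝ} (hν : |ν| ≤ 1 / 2) (i : ι) :
    T.dim i / 2 - T.k / 4 ≤ T.defectDim ν i := by
  have hk := T.k_pos
  have h1 : T.defectDim ν i = T.dim i + T.k * ν ^ 2 - 2 * T.k * ν * T.flow i := by
    rw [defectDim, flow, dim]; field_simp; ring
  have h2 : T.k * T.flow i ^ 2 ≤ T.dim i := by
    have h := T.reducedDim_nonneg i
    have e : T.k * T.flow i ^ 2 = (T.q i + T.qbar i) ^ 2 / (4 * T.k) := by
      rw [flow]; field_simp; ring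
    rw [reducedDim] at h; linarith
  have h3 : ν ^ 2 ≤ 1 / 4 := by
    rw [← sq_abs]; nlinarith [abs_nonneg ν]
  have h4 : 0 ≤ T.k * (T.flow i - 2 * ν) ^ 2 := by positivity
  nlinarith

end UnitaryU1CFT

/-! ### Modular covariance at complex temperature and projection to fixed charge. -/

theorem Complex.norm_exp_neg_mul_ofReal (z : ℂ) (x : ℝ) :
    ‖Complex.exp (-z * x)‖ = Real.exp (-z.re * x) := by
  rw [Complex.norm_exp]; simp

theorem Complex.norm_exp_two_pi_I_mul (x y : ℝ) :
    ‖Complex.exp (2 * Real.pi * Complex.I * x * y)‖ = 1 := by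
  rw [Complex.norm_exp]; simp

/-- A general Dirichlet series with bounded coefficients and nonnegative exponents is holomorphic in
the right half-plane. -/
theorem differentiableOn_tsum_exp_neg_mul {ι : Type*} {E : ι → ℝ} {a : ι → ℂ}
    (hE : ∀ i, 0 ≤ E i) (hs : ∀ s : ℝ, 0 < s → Summable fun i => Real.exp (-s * E i))
    (ha : ∀ i, ‖a i‖ ≤ 1) :
    DifferentiableOn ℂ (fun z : ℂ => ∑' i, Complex.exp (-z * E i) * a i) {z | 0 < z.re} := by
  intro z hz
  have hz' : 0 < z.re := hz
  -- On `Re w > Re z / 2` the series is dominated termwise by its value at the real point `Re z /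
  -- 2`, so it converges uniformly there.
  have ho : IsOpen {w : ℂ | z.re / 2 < w.re} := isOpen_lt continuous_const Complex.continuous_re
  have hd : DifferentiableOn ℂ (fun z : ℂ => ∑' i, Complex.exp (-z * E i) * a i)
      {w : ℂ | z.re / 2 < w.re} := by
    refine Complex.differentiableOn_tsum_of_summable_norm (hs (z.re / 2) (by positivity))
      (fun i => by fun_prop) ho (fun i w hw => ?_)
    have hw' : z.re / 2 < w.re := hw
    rw [norm_mul, Complex.norm_exp_neg_mul_ofReal]
    refine (mul_le_of_le_one_right (Real.exp_pos _).le (ha i)).trans (Real.exp_le_exp.mpr ?_)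
    nlinarith [hE i]
  exact (hd.differentiableAt (ho.mem_nhds (by simp only [Set.mem_ofPred_eq]; linarith))).differentiableWithinAt

theorem integral_exp_two_pi_int (n : ℤ) :
    ∫ ν in (-(1 / 2) : ℝ)..(1 / 2), Complex.exp (2 * Real.pi * Complex.I * n * ν) =
      if n = 0 then 1 else 0 := by
  split_ifs with h
  · simp [h]; norm_num
  · have hc : 2 * Real.pi * Complex.I * n ≠ 0 := by
      simp [h, Real.pi_ne_zero]
    rw [integral_exp_mul_complex hc, div_eq_zero_iff, sub_eq_zero]
    left
    rw [Complex.exp_eq_exp_iff_exists_int]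
    exact ⟨n, by push_cast; ring⟩

namespace UnitaryU1CFT

variable {H : Type*} [NormedAddCommGroup H] [InnerProductSpace ℂ H] {ι : Type*}

theorem countable_index (T : UnitaryU1CFT H ι) : Countable ι := by
  have h : (Set.univ : Set ι) = ⋃ n : ℕ, {i | T.dim i ≤ n} := by
    ext i
    simpa using exists_nat_ge (T.dim i)
  rw [← Set.countable_univ_iff, h]
  exact Set.countable_iUnion fun n => (T.finite_dim_le n).countable

theorem summable_exp_dim (T : UnitaryU1CFT H ι) {s : ℝ} (hs : 0 < s) :
    Summable fun i => Real.exp (-s * T.dim i) := T.summable_boltzmann s hs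

theorem exp_defectDim_le (T : UnitaryU1CFT H ι) {s ν : ℝ} (hs : 0 ≤ s) (hν : |ν| ≤ 1 / 2) (i : ι) :
    Real.exp (-s * T.defectDim ν i) ≤ Real.exp (s * T.k / 4) * Real.exp (-(s / 2) * T.dim i) := by
  rw [← Real.exp_add, Real.exp_le_exp]
  nlinarith [T.le_defectDim hν i]

theorem summable_exp_defectDim (T : UnitaryU1CFT H ι) {s ν : ℝ} (hs : 0 < s) (hν : |ν| ≤ 1 / 2) :
    Summable fun i => Real.exp (-s * T.defectDim ν i) :=
  Summable.of_nonneg_of_le (fun _ => (Real.exp_pos _).le) (T.exp_defectDim_le hs.le hν)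
    ((T.summable_exp_dim (half_pos hs)).mul_left _)

/-- Modular covariance extends to complex `β` in the right half-plane. -/
theorem IsModularCovariant.complex {T : UnitaryU1CFT H ι} (hT : T.IsModularCovariant) {ν : ℝ}
    (hν : ν ∈ Set.Ioc (-(1 / 2) : ℝ) (1 / 2)) {z : ℂ} (hz : 0 < z.re) :
    Complex.exp (z * (T.c / 12)) *
        ∑' i, Complex.exp (-z * T.dim i) * Complex.exp (2 * Real.pi * Complex.I * ν * T.charge i) =
      Complex.exp ((4 * Real.pi ^ 2 / z) * (T.c / 12)) *
        ∑' i, Complex.exp (-(4 * Real.pi ^ 2 / z) * T.defectDim ν i) := by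
  have hν' : |ν| ≤ 1 / 2 := abs_le.mpr ⟨hν.1.le, hν.2⟩
  have hne : ∀ w ∈ {w : ℂ | 0 < w.re}, w ≠ 0 := by
    rintro w hw rfl
    exact lt_irrefl _ (show (0 : ℝ) < (0 : ℂ).re from hw)
  have hinv : ∀ w ∈ {w : ℂ | 0 < w.re}, (4 * Real.pi ^ 2 / w) ∈ {w : ℂ | 0 < w.re} := by
    intro w hw
    have hw' : 0 < w.re := hw
    have hn : 0 < Complex.normSq w := Complex.normSq_pos.mpr (hne w hw)
    have : (4 * Real.pi ^ 2 / w).re = 4 * Real.pi ^ 2 * w.re / Complex.normSq w := by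
      rw [show (4 * Real.pi ^ 2 / w : ℂ) = ((4 * Real.pi ^ 2 : ℝ) : ℂ) * w⁻¹ by
        push_cast; rfl, Complex.re_ofReal_mul, Complex.inv_re, mul_div_assoc]
    simp only [Set.mem_ofPred_eq, this]
    have := Real.pi_pos
    positivity
  have ho : IsOpen {w : ℂ | 0 < w.re} := isOpen_lt continuous_const Complex.continuous_re
  have hd : DifferentiableOn ℂ (fun w : ℂ => 4 * Real.pi ^ 2 / w) {w : ℂ | 0 < w.re} :=
    (differentiableOn_const _).div differentiableOn_id hne
  have hf : DifferentiableOn ℂ (fun w : ℂ => Complex.exp (w * (T.c / 12)) *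
      ∑' i, Complex.exp (-w * T.dim i) * Complex.exp (2 * Real.pi * Complex.I * ν * T.charge i))
      {w : ℂ | 0 < w.re} := by
    refine DifferentiableOn.mul (by fun_prop) (differentiableOn_tsum_exp_neg_mul T.dim_nonneg
      (fun s hs => T.summable_exp_dim hs) (fun i => (Complex.norm_exp_two_pi_I_mul _ _).le))
  have hg : DifferentiableOn ℂ (fun w : ℂ => Complex.exp ((4 * Real.pi ^ 2 / w) * (T.c / 12)) *
      ∑' i, Complex.exp (-(4 * Real.pi ^ 2 / w) * T.defectDim ν i)) {w : ℂ | 0 < w.re} := by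
    refine DifferentiableOn.mul (hd.mul_const _).cexp ?_
    have := (differentiableOn_tsum_exp_neg_mul (a := fun _ => 1) (T.defectDim_nonneg ν)
      (fun s hs => T.summable_exp_defectDim hs hν') (fun i => by simp)).comp hd hinv
    simp only [mul_one] at this
    exact this
  -- Identity theorem: the two sides agree at the real points `1 + 1/(n+1)`, which accumulate at 1
  -- inside the half-plane.
  refine AnalyticOnNhd.eqOn_of_preconnected_of_frequently_eq (hf.analyticOnNhd ho)
    (hg.analyticOnNhd ho) (convex_halfSpace_re_gt 0).isPreconnected
    (show (1 : ℂ) ∈ {w : ℂ | 0 < w.re} by simp) ?_ hz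
  have hlim : Tendsto (fun n : ℕ => ((1 + 1 / ((n : ℝ) + 1) : ℝ) : ℂ)) atTop (𝓝[≠] 1) := by
    refine tendsto_nhdsWithin_iff.mpr ⟨?_, Eventually.of_forall fun n => ?_⟩
    · have := (Complex.continuous_ofReal.tendsto _).comp
        ((tendsto_one_div_add_atTop_nhds_zero_nat (𝕜 := ℝ)).const_add 1)
      rw [add_zero, Complex.ofReal_one] at this
      exact this
    · have : (0 : ℝ) < 1 / ((n : ℝ) + 1) := by positivity
      simp only [Set.mem_compl_iff, Set.mem_singleton_iff]
      rw [← Complex.ofReal_one, Complex.ofReal_inj]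
      linarith
  refine hlim.frequently (Eventually.frequently (Eventually.of_forall fun n => ?_))
  set β : ℝ := 1 + 1 / ((n : ℝ) + 1)
  have hβ : 0 < β := by positivity
  have h := hT β hβ ν hν
  rw [twistedZ, defectZ] at h
  rw [← tsum_mul_left, ← tsum_mul_left]
  refine (tsum_congr fun i => ?_).trans (h.trans (tsum_congr fun i => ?_))
  · rw [← mul_assoc, ← Complex.exp_add]; congr 2; ring
  · rw [← Complex.exp_add]; push_cast; congr 1; ring

/-- The contribution of a state to the charge-`Q` partition function in the dual channel. -/
def dualTerm (T : UnitaryU1CFT H ι) (Q : ℤ) (w : ℂ) (i : ι) : ℂ :=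
  ∫ ν in (-(1 / 2) : ℝ)..(1 / 2),
    Complex.exp (-(2 * Real.pi * Complex.I * ν * Q)) * Complex.exp (-w * T.defectDim ν i)

/-- The absolute value of the integrand of `dualTerm`, integrated. -/
def dualWeight (T : UnitaryU1CFT H ι) (s : ℝ) (i : ι) : ℝ :=
  ∫ ν in (-(1 / 2) : ℝ)..(1 / 2), Real.exp (-s * T.defectDim ν i)

/-- The charge-`Q` partition function without its Casimir energy. -/
def chargeZ (T : UnitaryU1CFT H ι) (Q : ℤ) (z : ℂ) : ℂ :=
  ∑' i, if T.charge i = Q then Complex.exp (-z * T.dim i) else 0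

theorem continuous_defectDim (T : UnitaryU1CFT H ι) (i : ι) :
    Continuous fun ν => T.defectDim ν i := by
  unfold defectDim; fun_prop

theorem norm_exp_neg_two_pi_I_mul_int (ν : ℝ) (Q : ℤ) :
    ‖Complex.exp (-(2 * Real.pi * Complex.I * ν * Q))‖ = 1 := by
  rw [Complex.norm_exp]; simp

theorem norm_dualTerm_le (T : UnitaryU1CFT H ι) (Q : ℤ) (w : ℂ) (i : ι) :
    ‖T.dualTerm Q w i‖ ≤ T.dualWeight w.re i := by
  refine (intervalIntegral.norm_integral_le_integral_norm (by norm_num)).trans_eq ?_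
  refine intervalIntegral.integral_congr fun ν _ => ?_
  simp only [norm_mul, norm_exp_neg_two_pi_I_mul_int, Complex.norm_exp_neg_mul_ofReal, one_mul]

theorem dualWeight_nonneg (T : UnitaryU1CFT H ι) (s : ℝ) (i : ι) : 0 ≤ T.dualWeight s i :=
  intervalIntegral.integral_nonneg (by norm_num) fun _ _ => (Real.exp_pos _).le

/-- At charge zero and real temperature nothing oscillates, so the sum of absolute weights is itself
a dual-channel partition function. This permits a second modular transformation in
`exists_norm_chargeZ_le`. -/
theorem dualTerm_zero (T : UnitaryU1CFT H ι) (s : ℝ) (i : ι) :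
    T.dualTerm 0 s i = T.dualWeight s i := by
  rw [dualTerm, dualWeight, ← intervalIntegral.integral_ofReal]
  refine intervalIntegral.integral_congr fun ν _ => ?_
  simp

theorem dualWeight_le (T : UnitaryU1CFT H ι) {s : ℝ} (hs : 0 ≤ s) (i : ι) :
    T.dualWeight s i ≤ Real.exp (s * T.k / 4) * Real.exp (-(s / 2) * T.dim i) := by
  have hi : ∀ f : ℝ → ℝ, Continuous f → IntervalIntegrable f volume (-(1 / 2)) (1 / 2) :=
    fun f hf => hf.intervalIntegrable _ _
  have hc := T.continuous_defectDim i
  refine (intervalIntegral.integral_mono_on (by norm_num) (hi _ (by fun_prop))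
    (hi _ (continuous_const (y := Real.exp (s * T.k / 4) * Real.exp (-(s / 2) * T.dim i))))
    fun ν hν => T.exp_defectDim_le hs (abs_le.mpr hν) i).trans_eq ?_
  rw [intervalIntegral.integral_const]; norm_num

theorem summable_dualWeight (T : UnitaryU1CFT H ι) {s : ℝ} (hs : 0 < s) :
    Summable (T.dualWeight s) :=
  Summable.of_nonneg_of_le (T.dualWeight_nonneg s) (T.dualWeight_le hs.le)
    ((T.summable_exp_dim (half_pos hs)).mul_left _)

/-- Orthogonality of the characters of `U(1)`: integrality of the charges makes the integral over
`ν` a projection. -/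
theorem integral_twist_eq_chargeZ {T : UnitaryU1CFT H ι} (hT : T.IsFaithfulCompact) (Q : ℤ) {z : ℂ}
    (hz : 0 < z.re) :
    ∫ ν in (-(1 / 2) : ℝ)..(1 / 2), Complex.exp (-(2 * Real.pi * Complex.I * ν * Q)) *
        ∑' i, Complex.exp (-z * T.dim i) * Complex.exp (2 * Real.pi * Complex.I * ν * T.charge i) =
      T.chargeZ Q z := by
  have := T.countable_index
  simp only [← tsum_mul_left]
  have h := intervalIntegral.hasSum_integral_of_dominated_convergence (μ := volume)
    (a := (-(1 / 2) : ℝ)) (b := 1 / 2)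
    (F := fun i ν => Complex.exp (-(2 * Real.pi * Complex.I * ν * Q)) *
      (Complex.exp (-z * T.dim i) * Complex.exp (2 * Real.pi * Complex.I * ν * T.charge i)))
    (f := fun ν => ∑' i, Complex.exp (-(2 * Real.pi * Complex.I * ν * Q)) *
      (Complex.exp (-z * T.dim i) * Complex.exp (2 * Real.pi * Complex.I * ν * T.charge i)))
    (fun i _ => Real.exp (-z.re * T.dim i))
    (fun i => by fun_prop)
    (fun i => Eventually.of_forall fun ν _ => by
      rw [norm_mul, norm_mul, norm_exp_neg_two_pi_I_mul_int, Complex.norm_exp_two_pi_I_mul,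
        Complex.norm_exp_neg_mul_ofReal, one_mul, mul_one])
    (Eventually.of_forall fun ν _ => T.summable_exp_dim hz)
    (by simp)
    (Eventually.of_forall fun ν _ => (Summable.hasSum (Summable.of_norm_bounded
      (T.summable_exp_dim hz) fun i => by
        rw [norm_mul, norm_mul, norm_exp_neg_two_pi_I_mul_int, Complex.norm_exp_two_pi_I_mul,
        Complex.norm_exp_neg_mul_ofReal, one_mul, mul_one])))
  rw [← h.tsum_eq, chargeZ]
  refine tsum_congr fun i => ?_
  obtain ⟨n, hn⟩ := hT.1 i
  have e : ∀ ν : ℝ, Complex.exp (-(2 * Real.pi * Complex.I * ν * Q)) *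
      (Complex.exp (-z * T.dim i) * Complex.exp (2 * Real.pi * Complex.I * ν * T.charge i)) =
      Complex.exp (-z * T.dim i) *
        Complex.exp (2 * Real.pi * Complex.I * ((n - Q : ℤ) : ℂ) * ν) := by
    intro ν
    rw [mul_left_comm, ← Complex.exp_add, hn]
    congr 2; push_cast; ring
  rw [intervalIntegral.integral_congr fun ν _ => e ν, intervalIntegral.integral_const_mul,
    integral_exp_two_pi_int, hn]
  simp only [sub_eq_zero, Int.cast_inj, mul_ite, mul_one, mul_zero]

theorem integral_defect_eq_tsum_dualTerm (T : UnitaryU1CFT H ι) (Q : ℤ) {w : ℂ} (hw : 0 < w.re) :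
    ∫ ν in (-(1 / 2) : ℝ)..(1 / 2), Complex.exp (-(2 * Real.pi * Complex.I * ν * Q)) *
        ∑' i, Complex.exp (-w * T.defectDim ν i) =
      ∑' i, T.dualTerm Q w i := by
  have := T.countable_index
  simp only [← tsum_mul_left]
  have hb : ∀ i, ∀ ν ∈ Set.uIoc (-(1 / 2) : ℝ) (1 / 2),
      ‖Complex.exp (-(2 * Real.pi * Complex.I * ν * Q)) * Complex.exp (-w * T.defectDim ν i)‖ ≤
        Real.exp (w.re * T.k / 4) * Real.exp (-(w.re / 2) * T.dim i) := by
    intro i ν hν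
    rw [Set.uIoc_of_le (by norm_num)] at hν
    rw [norm_mul, norm_exp_neg_two_pi_I_mul_int, one_mul, Complex.norm_exp_neg_mul_ofReal]
    exact T.exp_defectDim_le hw.le (abs_le.mpr ⟨hν.1.le, hν.2⟩) i
  have hs := (T.summable_exp_dim (half_pos hw)).mul_left (Real.exp (w.re * T.k / 4))
  have h := intervalIntegral.hasSum_integral_of_dominated_convergence (μ := volume)
    (a := (-(1 / 2) : ℝ)) (b := 1 / 2)
    (F := fun i ν => Complex.exp (-(2 * Real.pi * Complex.I * ν * Q)) *
      Complex.exp (-w * T.defectDim ν i))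
    (f := fun ν => ∑' i, Complex.exp (-(2 * Real.pi * Complex.I * ν * Q)) *
      Complex.exp (-w * T.defectDim ν i))
    (fun i _ => Real.exp (w.re * T.k / 4) * Real.exp (-(w.re / 2) * T.dim i))
    (fun i => by
      have := T.continuous_defectDim i
      exact Continuous.aestronglyMeasurable (by fun_prop))
    (fun i => Eventually.of_forall (hb i))
    (Eventually.of_forall fun ν _ => hs)
    (by simp)
    (Eventually.of_forall fun ν hν => (Summable.hasSum (Summable.of_norm_bounded
      hs fun i => hb i ν hν)))
  exact h.tsum_eq.symm

/-- The modular transform of the charge-`Q` partition function. -/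
theorem IsModularCovariant.chargeZ_eq {T : UnitaryU1CFT H ι} (hT : T.IsModularCovariant)
    (hF : T.IsFaithfulCompact) (Q : ℤ) {z : ℂ} (hz : 0 < z.re) :
    Complex.exp (z * (T.c / 12)) * T.chargeZ Q z =
      Complex.exp ((4 * Real.pi ^ 2 / z) * (T.c / 12)) *
        ∑' i, T.dualTerm Q (4 * Real.pi ^ 2 / z) i := by
  have hz0 : z ≠ 0 := by rintro rfl; simp at hz
  have hw : 0 < (4 * Real.pi ^ 2 / z).re := by
    have hn : 0 < Complex.normSq z := Complex.normSq_pos.mpr hz0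
    rw [show (4 * Real.pi ^ 2 / z : ℂ) = ((4 * Real.pi ^ 2 : ℝ) : ℂ) * z⁻¹ by
      push_cast; rfl, Complex.re_ofReal_mul, Complex.inv_re]
    have := Real.pi_pos
    positivity
  rw [← integral_twist_eq_chargeZ hF Q hz, ← T.integral_defect_eq_tsum_dualTerm Q hw,
    ← intervalIntegral.integral_const_mul, ← intervalIntegral.integral_const_mul]
  -- Comparing on the half-open interval avoids `ν = -1/2`, where covariance is not assumed.
  refine intervalIntegral.integral_congr_ae (Eventually.of_forall fun ν hν => ?_)
  rw [Set.uIoc_of_le (by norm_num)] at hν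
  rw [mul_left_comm, hT.complex hν hz, mul_left_comm]

end UnitaryU1CFT

/-! ### Bounds and leading asymptotics of the dual channel. -/

theorem Complex.four_pi_sq_div_re (z : ℂ) :
    (4 * Real.pi ^ 2 / z).re = 4 * Real.pi ^ 2 * (z.re / Complex.normSq z) := by
  rw [show (4 * Real.pi ^ 2 / z : ℂ) = ((4 * Real.pi ^ 2 : ℝ) : ℂ) * z⁻¹ by
      push_cast; rfl, Complex.re_ofReal_mul, Complex.inv_re]

theorem Complex.four_pi_sq_div_re_pos {z : ℂ} (hz : 0 < z.re) : 0 < (4 * Real.pi ^ 2 / z).re := by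
  have hz0 : z ≠ 0 := by rintro rfl; simp at hz
  have hn : 0 < Complex.normSq z := Complex.normSq_pos.mpr hz0
  rw [Complex.four_pi_sq_div_re]
  have := Real.pi_pos
  positivity

theorem Real.integral_gaussian_Iio (b : ℝ) :
    ∫ x in Set.Iio (0 : ℝ), Real.exp (-b * x ^ 2) = √(Real.pi / b) / 2 := by
  have h := integral_comp_neg_Ioi (0 : ℝ) (fun x => Real.exp (-b * x ^ 2))
  rw [← integral_Iic_eq_integral_Iio]
  simp only [neg_sq, neg_zero, integral_gaussian_Ioi] at h
  exact h.symm

/-- The limiting weight of a Gaussian centred at `x` on the window `(-1/2, 1/2]`. -/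
def edgeWeight (x : ℝ) : ℝ := if |x| < 1 / 2 then 1 else if |x| = 1 / 2 then 1 / 2 else 0

/-- A narrow Gaussian on `(-1/2, 1/2]`, with complex variance of argument tending to zero. -/
theorem tendsto_sqrt_mul_integral_gaussian {α : Type*} {l : Filter α} [l.IsCountablyGenerated]
    {w : α → ℂ} (hw : Tendsto (fun a => (w a).re) l atTop)
    (hw1 : Tendsto (fun a => w a / (w a).re) l (𝓝 1)) {k : ℝ} (hk : 0 < k) (x : ℝ) (Q : ℤ) :
    Tendsto (fun a => (√(w a).re : ℂ) * ∫ ν in (-(1 / 2) : ℝ)..(1 / 2),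
        Complex.exp (-(2 * Real.pi * Complex.I * ν * Q)) *
          Complex.exp (-w a * (k * (ν - x) ^ 2))) l
      (𝓝 (Complex.exp (-(2 * Real.pi * Complex.I * x * Q)) * (edgeWeight x * √(Real.pi / k) : ℝ))) := by
  set S : Set ℝ := Set.Ioc (-(1 / 2)) (1 / 2)
  set f : α → ℝ → ℂ := fun a ν => S.indicator (fun ν : ℝ =>
    Complex.exp (-(2 * Real.pi * Complex.I * ν * Q)) * Complex.exp (-w a * (k * (ν - x) ^ 2))) ν
  -- After the substitution `ν = x + y/√Re w` the window becomes the whole line, a half-line or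
  -- empty in the limit, according as its centre is interior, an endpoint or exterior.
  set p : ℝ → ℝ := fun y => if |x| < 1 / 2 then 1 else
    if x = 1 / 2 then (Set.Iio 0).indicator 1 y else
      if x = -(1 / 2) then (Set.Ioi 0).indicator 1 y else 0 with hp
  have hr : Tendsto (fun a => (√(w a).re)⁻¹) l (𝓝 0) :=
    (Real.tendsto_sqrt_atTop.comp hw).inv_tendsto_atTop
  have hlim : ∫ y : ℝ, Complex.exp (-(2 * Real.pi * Complex.I * x * Q)) *
      ((p y * Real.exp (-k * y ^ 2) : ℝ) : ℂ) =
      Complex.exp (-(2 * Real.pi * Complex.I * x * Q)) * (edgeWeight x * √(Real.pi / k) : ℝ) := by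
    rw [integral_const_mul, integral_complex_ofReal]
    congr 2
    have hI : ∀ (U : Set ℝ) (g : ℝ → ℝ), (fun y => U.indicator (1 : ℝ → ℝ) y * g y) =
        U.indicator g := by
      intro U g; ext y; by_cases hy : y ∈ U <;> simp [hy]
    simp only [hp, edgeWeight]
    split_ifs with h1 h2 h3 h4 h5 h6
    · simp only [one_mul, integral_gaussian]
    · rw [hI, integral_indicator measurableSet_Iio, Real.integral_gaussian_Iio]; ring
    · exact absurd (by rw [h2]; norm_num) h3
    · rw [hI, integral_indicator measurableSet_Ioi, integral_gaussian_Ioi]; ring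
    · exact absurd (by rw [h4]; norm_num) h5
    · rcases abs_cases x with h | h
      · exact absurd (by linarith) h2
      · exact absurd (by linarith) h4
    · simp
  rw [← hlim]
  have key : Tendsto (fun a => ∫ y : ℝ, f a (x + y * (√(w a).re)⁻¹)) l
      (𝓝 (∫ y : ℝ, Complex.exp (-(2 * Real.pi * Complex.I * x * Q)) *
      ((p y * Real.exp (-k * y ^ 2) : ℝ) : ℂ))) := by
    refine tendsto_integral_filter_of_dominated_convergence (fun y => Real.exp (-k * y ^ 2))
      ?_ ?_ (integrable_exp_neg_mul_sq hk) ?_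
    · refine Eventually.of_forall fun a => Measurable.aestronglyMeasurable ?_
      have : Measurable (f a) := Measurable.indicator (by fun_prop) measurableSet_Ioc
      exact this.comp (by fun_prop)
    · filter_upwards [hw.eventually_gt_atTop 0] with a ha
      refine Eventually.of_forall fun y => ?_
      refine (norm_indicator_le_norm_self _ _).trans ?_
      rw [norm_mul, UnitaryU1CFT.norm_exp_neg_two_pi_I_mul_int, one_mul]
      have := Complex.norm_exp_neg_mul_ofReal (w a) (k * (x + y * (√(w a).re)⁻¹ - x) ^ 2)
      push_cast at this ⊢
      rw [this, Real.exp_le_exp]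
      apply le_of_eq
      have h2 : (√(w a).re)⁻¹ ^ 2 = (w a).re⁻¹ := by rw [inv_pow, Real.sq_sqrt ha.le]
      rw [add_sub_cancel_left, mul_pow, h2]; field_simp
    -- The point `y = 0` is discarded because at an endpoint centre the limiting indicator is read
    -- off from the sign of `y`.
    · have h0 : ∀ᵐ y : ℝ, y ≠ 0 := by simp [ae_iff]
      filter_upwards [h0] with y hy
      have hν : Tendsto (fun a => x + y * (√(w a).re)⁻¹) l (𝓝 x) := by
        simpa using (hr.const_mul y).const_add x
      have hind : Tendsto (fun a => S.indicator (1 : ℝ → ℂ) (x + y * (√(w a).re)⁻¹)) l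
          (𝓝 (p y : ℂ)) := by
        have one : (∀ᶠ a in l, x + y * (√(w a).re)⁻¹ ∈ S) → p y = 1 →
            Tendsto (fun a => S.indicator (1 : ℝ → ℂ) (x + y * (√(w a).re)⁻¹)) l
          (𝓝 (p y : ℂ)) := fun h h' => by
          rw [h', Complex.ofReal_one]
          refine tendsto_const_nhds.congr' ?_
          filter_upwards [h] with a ha
          rw [Set.indicator_of_mem ha]; rfl
        have zero : (∀ᶠ a in l, x + y * (√(w a).re)⁻¹ ∉ S) → p y = 0 →
            Tendsto (fun a => S.indicator (1 : ℝ → ℂ) (x + y * (√(w a).re)⁻¹)) l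
          (𝓝 (p y : ℂ)) := fun h h' => by
          rw [h', Complex.ofReal_zero]
          refine tendsto_const_nhds.congr' ?_
          filter_upwards [h] with a ha
          rw [Set.indicator_of_notMem ha]
        by_cases h1 : |x| < 1 / 2
        · obtain ⟨ha, hb⟩ := abs_lt.mp h1
          exact one (by
            filter_upwards [hν.eventually (Ioo_mem_nhds ha hb)] with a h using ⟨h.1, h.2.le⟩)
            (by simp only [hp, if_pos h1])
        by_cases h2 : x = 1 / 2
        · rcases lt_or_gt_of_ne hy with hy | hy
          · refine one ?_ (by simp only [hp, if_neg h1, if_pos h2]; simp [hy])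
            filter_upwards [hν.eventually (lt_mem_nhds (show -(1 / 2) < x by rw [h2]; norm_num)),
              hw.eventually_gt_atTop 0] with a h h'
            refine ⟨h, ?_⟩
            have : 0 < (√(w a).re)⁻¹ := by positivity
            nlinarith
          · refine zero ?_ (by simp only [hp, if_neg h1, if_pos h2]; simp [hy.le])
            filter_upwards [hw.eventually_gt_atTop 0] with a h' h
            have : 0 < (√(w a).re)⁻¹ := by positivity
            nlinarith [h.2]
        by_cases h3 : x = -(1 / 2)
        · rcases lt_or_gt_of_ne hy with hy | hy
          · refine zero ?_ (by simp only [hp, if_neg h1, if_neg h2, if_pos h3]; simp [hy.le])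
            filter_upwards [hw.eventually_gt_atTop 0] with a h' h
            have : 0 < (√(w a).re)⁻¹ := by positivity
            nlinarith [h.1]
          · refine one ?_ (by simp only [hp, if_neg h1, if_neg h2, if_pos h3]; simp [hy])
            filter_upwards [hν.eventually (gt_mem_nhds (show x < 1 / 2 by rw [h3]; norm_num)),
              hw.eventually_gt_atTop 0] with a h h'
            refine ⟨?_, h.le⟩
            have : 0 < (√(w a).re)⁻¹ := by positivity
            nlinarith
        refine zero ?_ (by simp only [hp, if_neg h1, if_neg h2, if_neg h3])
        rcases lt_or_ge x 0 with hx | hx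
        · have : x < -(1 / 2) := by
            rw [abs_of_neg hx] at h1
            exact lt_of_le_of_ne (by linarith) h3
          filter_upwards [hν.eventually (gt_mem_nhds this)] with a h h'
          linarith [h'.1]
        · have : 1 / 2 < x := by
            rw [abs_of_nonneg hx] at h1
            exact lt_of_le_of_ne (by linarith) (Ne.symm h2)
          filter_upwards [hν.eventually (lt_mem_nhds this)] with a h h'
          linarith [h'.2]
      have hexp : Tendsto (fun a => Complex.exp (-(2 * Real.pi * Complex.I *
          ((x + y * (√(w a).re)⁻¹ : ℝ) : ℂ) * Q))) l
          (𝓝 (Complex.exp (-(2 * Real.pi * Complex.I * x * Q)))) := by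
        have hc : Continuous fun ν : ℝ => Complex.exp (-(2 * Real.pi * Complex.I * (ν : ℂ) * Q)) := by
          fun_prop
        exact (hc.tendsto x).comp hν
      have hgauss : Tendsto (fun a => Complex.exp (-(w a / (w a).re) * (k * y ^ 2))) l
          (𝓝 (Complex.exp (-1 * (k * y ^ 2)))) :=
        (Complex.continuous_exp.tendsto _).comp (hw1.neg.mul_const _)
      have := (hind.mul (hexp.mul hgauss))
      have e : (p y : ℂ) * (Complex.exp (-(2 * Real.pi * Complex.I * x * Q)) *
          Complex.exp (-1 * (k * y ^ 2))) = Complex.exp (-(2 * Real.pi * Complex.I * x * Q)) *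
      ((p y * Real.exp (-k * y ^ 2) : ℝ) : ℂ) := by
        push_cast; rw [mul_left_comm]; congr 3; ring
      rw [e] at this
      refine this.congr' ?_
      filter_upwards [hw.eventually_gt_atTop 0] with a ha
      simp only [f]
      rw [Set.indicator_apply, Set.indicator_apply]
      split_ifs
      · rw [Pi.one_apply, one_mul]
        congr 2
        have h2 : ((√(w a).re : ℝ) : ℂ)⁻¹ ^ 2 = ((w a).re : ℂ)⁻¹ := by
          rw [inv_pow, ← Complex.ofReal_pow, Real.sq_sqrt ha.le]
        push_cast
        rw [add_sub_cancel_left, mul_pow, h2]; field_simp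
      · simp
  refine key.congr' ?_
  filter_upwards [hw.eventually_gt_atTop 0] with a ha
  have hs : 0 < (√(w a).re)⁻¹ := by positivity
  have h1 := Measure.integral_comp_mul_right (fun y => f a (x + y)) (√(w a).re)⁻¹
  rw [h1, integral_add_left_eq_self (f a) x, intervalIntegral.integral_of_le (by norm_num),
    ← integral_indicator measurableSet_Ioc, inv_inv, abs_of_nonneg (Real.sqrt_nonneg _),
    Complex.real_smul]

namespace UnitaryU1CFT

variable {H : Type*} [NormedAddCommGroup H] [InnerProductSpace ℂ H] {ι : Type*}

theorem norm_tsum_dualTerm_le (T : UnitaryU1CFT H ι) (Q : ℤ) {w : ℂ} (hw : 0 < w.re) :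
    ‖∑' i, T.dualTerm Q w i‖ ≤ ∑' i, T.dualWeight w.re i :=
  tsum_of_norm_bounded (T.summable_dualWeight hw).hasSum (T.norm_dualTerm_le Q w)

theorem dualWeight_anti (T : UnitaryU1CFT H ι) {s t : ℝ} (h : s ≤ t) (i : ι) :
    T.dualWeight t i ≤ T.dualWeight s i := by
  have hc := T.continuous_defectDim i
  refine intervalIntegral.integral_mono_on (by norm_num)
    (Continuous.intervalIntegrable (by fun_prop) _ _)
    (Continuous.intervalIntegrable (by fun_prop) _ _) fun ν _ => ?_
  rw [Real.exp_le_exp]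
  nlinarith [T.defectDim_nonneg ν i]

/-- A bound on the charge-`Q` partition function in the whole right half-plane. -/
theorem exists_norm_chargeZ_le {T : UnitaryU1CFT H ι} (hF : T.IsFaithfulCompact)
    (hT : T.IsModularCovariant) : ∃ C : ℝ, 0 < C ∧ ∀ (Q : ℤ) (z : ℂ), 0 < z.re →
      ‖Complex.exp (z * (T.c / 12)) * T.chargeZ Q z‖ ≤
        C * (Real.exp ((4 * Real.pi ^ 2 / z).re * (T.c / 12)) +
          Real.exp (4 * Real.pi ^ 2 / (4 * Real.pi ^ 2 / z).re * (T.c / 12))) := by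
  set C₁ := ∑' i, T.dualWeight 1 i
  set C₂ := ∑' i, Real.exp (-(4 * Real.pi ^ 2) * T.dim i)
  have hC₁ : 0 ≤ C₁ := tsum_nonneg (T.dualWeight_nonneg 1)
  have hC₂ : 0 ≤ C₂ := tsum_nonneg fun _ => (Real.exp_pos _).le
  have hpi := Real.pi_pos
  refine ⟨C₁ + C₂ + 1, by positivity, fun Q z hz => ?_⟩
  have hs := Complex.four_pi_sq_div_re_pos hz
  rw [hT.chargeZ_eq hF Q hz, norm_mul]
  set s := (4 * Real.pi ^ 2 / z).re
  have h1 : ‖Complex.exp (4 * Real.pi ^ 2 / z * (T.c / 12))‖ = Real.exp (s * (T.c / 12)) := by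
    rw [Complex.norm_exp, show (T.c / 12 : ℂ) = ((T.c / 12 : ℝ) : ℂ) by push_cast; rfl,
      Complex.re_mul_ofReal]
  rw [h1]
  have h2 := T.norm_tsum_dualTerm_le Q hs
  have e1 := Real.exp_pos (s * (T.c / 12))
  have e2 := Real.exp_pos (4 * Real.pi ^ 2 / s * (T.c / 12))
  -- For `s ≥ 1` the weights are monotone in `s`. For `s ≤ 1` their sum is converted to the
  -- charge-zero partition function at `4π²/s ≥ 4π²`, which is bounded; the price is the Casimir
  -- factor `exp((4π²/s)c/12)`.
  rcases le_total 1 s with h | h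
  · have h3 : ∑' i, T.dualWeight s i ≤ C₁ :=
      (T.summable_dualWeight hs).tsum_le_tsum (T.dualWeight_anti h) (T.summable_dualWeight one_pos)
    calc _ ≤ Real.exp (s * (T.c / 12)) * C₁ := by gcongr; exact h2.trans h3
      _ ≤ _ := by nlinarith
  · have hre : 0 < ((4 * Real.pi ^ 2 / s : ℝ) : ℂ).re := by rw [Complex.ofReal_re]; positivity
    have h3 := hT.chargeZ_eq hF 0 hre
    have h4 : (4 * Real.pi ^ 2 / ((4 * Real.pi ^ 2 / s : ℝ) : ℂ)) = (s : ℂ) := by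
      push_cast; field_simp
    rw [h4] at h3
    simp only [T.dualTerm_zero, ← Complex.ofReal_tsum] at h3
    have h5 := congrArg norm h3
    rw [norm_mul, norm_mul, Complex.norm_real, Real.norm_of_nonneg
      (tsum_nonneg (T.dualWeight_nonneg s)), show (T.c / 12 : ℂ) = ((T.c / 12 : ℝ) : ℂ) by
      push_cast; rfl, ← Complex.ofReal_mul, ← Complex.ofReal_mul, Complex.norm_exp_ofReal,
      Complex.norm_exp_ofReal] at h5
    have h6 : ‖T.chargeZ 0 ((4 * Real.pi ^ 2 / s : ℝ) : ℂ)‖ ≤ C₂ := by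
      refine tsum_of_norm_bounded (T.summable_exp_dim (by positivity)).hasSum fun i => ?_
      have h7 : Real.exp (-(4 * Real.pi ^ 2 / s) * T.dim i) ≤
          Real.exp (-(4 * Real.pi ^ 2) * T.dim i) := by
        rw [Real.exp_le_exp]
        have : 4 * Real.pi ^ 2 ≤ 4 * Real.pi ^ 2 / s := by
          rw [le_div_iff₀ hs]; nlinarith [sq_nonneg Real.pi]
        nlinarith [T.dim_nonneg i]
      split_ifs
      · rw [Complex.norm_exp_neg_mul_ofReal, Complex.ofReal_re]; exact h7
      · rw [norm_zero]; exact (Real.exp_pos _).le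
    calc _ ≤ Real.exp (s * (T.c / 12)) * ∑' i, T.dualWeight s i := by gcongr
      _ ≤ Real.exp (4 * Real.pi ^ 2 / s * (T.c / 12)) * C₂ := by rw [← h5]; gcongr
      _ ≤ _ := by nlinarith

/-- Drop `Δ̂ ≥ 0` and extend the Gaussian from the window to the whole line. -/
theorem dualWeight_le_sqrt (T : UnitaryU1CFT H ι) {s : ℝ} (hs : 0 < s) (i : ι) :
    √s * T.dualWeight s i ≤ √(Real.pi / T.k) := by
  have hk := T.k_pos
  have hsk : 0 < s * T.k := by positivity
  have hc := T.continuous_defectDim i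
  have hint : Integrable fun ν : ℝ => Real.exp (-(s * T.k) * (ν - T.flow i) ^ 2) :=
    (integrable_exp_neg_mul_sq hsk).comp_sub_right (T.flow i)
  have h1 : T.dualWeight s i ≤ √(Real.pi / (s * T.k)) := by
    rw [← integral_gaussian, ← integral_sub_right_eq_self _ (T.flow i), dualWeight,
      intervalIntegral.integral_of_le (by norm_num)]
    refine le_trans (setIntegral_mono (Continuous.integrableOn_Ioc (by fun_prop))
      hint.integrableOn fun ν => ?_) (setIntegral_le_integral hint
        (Eventually.of_forall fun _ => (Real.exp_pos _).le))
    simp only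
    rw [Real.exp_le_exp, defectDim_eq]
    nlinarith [T.reducedDim_nonneg i]
  calc _ ≤ √s * √(Real.pi / (s * T.k)) := by gcongr
    _ = _ := by
      rw [← Real.sqrt_mul hs.le]; congr 1; field_simp

/-- A summable majorant independent of `s`. If `Δ ≥ k/2 + 2` the defect dimension `E` is at least 1
on the whole window, so `√s ≤ e^{s/2}` is absorbed and `s(E - 1/2) ≥ E/2 ≥ Δ/4 - k/8`. For the
remaining states the Gaussian bound suffices, and the factor `e^{(k/2+2)/4}` compensates `e^{-Δ/4}`.
-/
theorem exists_sqrt_mul_dualWeight_le (T : UnitaryU1CFT H ι) : ∃ K : ℝ, 0 < K ∧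
    ∀ s : ℝ, 1 ≤ s → ∀ i, √s * T.dualWeight s i ≤ K * Real.exp (-(1 / 4) * T.dim i) := by
  have hk := T.k_pos
  refine ⟨Real.exp (T.k / 8) + √(Real.pi / T.k) * Real.exp ((T.k / 2 + 2) / 4), by positivity,
    fun s hs i => ?_⟩
  have hs0 : 0 < s := by linarith
  rw [add_mul]
  rcases le_total (T.k / 2 + 2) (T.dim i) with h | h
  · refine le_add_of_le_of_nonneg ?_ (by positivity)
    have hb : ∀ ν ∈ Set.Icc (-(1 / 2) : ℝ) (1 / 2), Real.exp (-s * T.defectDim ν i) ≤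
        (√s)⁻¹ * (Real.exp (T.k / 8) * Real.exp (-(1 / 4) * T.dim i)) := by
      intro ν hν
      have hE := T.le_defectDim (abs_le.mpr hν) i
      have h1 : √s ≤ Real.exp (s / 2) := by
        rw [Real.exp_half]
        exact Real.sqrt_le_sqrt (by linarith [Real.add_one_le_exp s])
      have hsq : 0 < √s := by positivity
      rw [inv_mul_eq_div, le_div_iff₀ hsq, mul_comm, ← Real.exp_add]
      calc _ ≤ Real.exp (s / 2) * Real.exp (-s * T.defectDim ν i) := by gcongr
        _ ≤ _ := by
          rw [← Real.exp_add, Real.exp_le_exp]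
          nlinarith
    have hc := T.continuous_defectDim i
    have h2 := intervalIntegral.integral_mono_on (by norm_num)
      (Continuous.intervalIntegrable (by fun_prop) _ _) (intervalIntegrable_const (μ := volume)) hb
    rw [intervalIntegral.integral_const] at h2
    rw [← dualWeight] at h2
    norm_num at h2
    calc _ ≤ √s * ((√s)⁻¹ * (Real.exp (T.k / 8) * Real.exp (-(1 / 4 * T.dim i)))) := by gcongr
      _ = _ := by
        rw [← mul_assoc, mul_inv_cancel₀ (by positivity), one_mul]; ring_nf
  · refine le_add_of_nonneg_of_le (by positivity) ((T.dualWeight_le_sqrt hs0 i).trans ?_)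
    rw [mul_assoc, ← Real.exp_add]
    refine le_mul_of_one_le_right (Real.sqrt_nonneg _) (Real.one_le_exp ?_)
    linarith

/-- The dual channel is `O(1/√s)`, uniformly in the charge. -/
theorem exists_sqrt_mul_norm_tsum_dualTerm_le (T : UnitaryU1CFT H ι) : ∃ K : ℝ, 0 < K ∧
    ∀ (Q : ℤ) (w : ℂ), 1 ≤ w.re → √w.re * ‖∑' i, T.dualTerm Q w i‖ ≤ K := by
  obtain ⟨K, hK, h⟩ := T.exists_sqrt_mul_dualWeight_le
  have hsum := (T.summable_exp_dim (s := 1 / 4) (by norm_num)).mul_left K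
  refine ⟨(∑' i, K * Real.exp (-(1 / 4) * T.dim i)) + 1, ?_, fun Q w hw => ?_⟩
  · have : 0 ≤ ∑' i, K * Real.exp (-(1 / 4) * T.dim i) := tsum_nonneg fun i => by positivity
    linarith
  · have hw0 : 0 < w.re := by linarith
    calc _ ≤ √w.re * ∑' i, T.dualWeight w.re i := by
          gcongr; exact T.norm_tsum_dualTerm_le Q hw0
      _ = ∑' i, √w.re * T.dualWeight w.re i := tsum_mul_left.symm
      _ ≤ ∑' i, K * Real.exp (-(1 / 4) * T.dim i) :=
          ((T.summable_dualWeight hw0).mul_left _).tsum_le_tsum (h _ hw) hsum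
      _ ≤ _ := by linarith

-- The term factors as `e^{-wΔ̂}` times a Gaussian integral centred at the flow. A positive `Δ̂`
-- kills it exponentially; otherwise `edgeWeight` at the flow is exactly the weight `w(q)` of `N_0`.
open Classical in
theorem tendsto_sqrt_mul_dualTerm (T : UnitaryU1CFT H ι) (Q : ℤ) {α : Type*} {l : Filter α}
    [l.IsCountablyGenerated] {w : α → ℂ} (hw : Tendsto (fun a => (w a).re) l atTop)
    (hw1 : Tendsto (fun a => w a / (w a).re) l (𝓝 1)) (i : ι) :
    Tendsto (fun a => (√(w a).re : ℂ) * T.dualTerm Q (w a) i) l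
      (𝓝 (√(Real.pi / T.k) * if T.IsLeading i then (if |T.q i| < T.k / 2 then 1 else 1 / 2) *
      Complex.exp (-(2 * Real.pi * Complex.I * T.q i * Q / T.k)) else 0)) := by
  have hk := T.k_pos
  have h1 := tendsto_sqrt_mul_integral_gaussian hw hw1 hk (T.flow i) Q
  have e : ∀ a, (√(w a).re : ℂ) * T.dualTerm Q (w a) i =
      Complex.exp (-w a * T.reducedDim i) * ((√(w a).re : ℂ) * ∫ ν in (-(1 / 2) : ℝ)..(1 / 2),
        Complex.exp (-(2 * Real.pi * Complex.I * ν * Q)) *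
          Complex.exp (-w a * (T.k * (ν - T.flow i) ^ 2))) := by
    intro a
    rw [mul_left_comm, ← intervalIntegral.integral_const_mul, dualTerm]
    congr 2
    ext ν
    simp only [← Complex.exp_add, defectDim_eq]
    congr 1; push_cast; ring
  simp only [e]
  rcases (T.reducedDim_nonneg i).eq_or_lt with h0 | h0
  · simp only [← h0, Complex.ofReal_zero, mul_zero, Complex.exp_zero, one_mul]
    convert h1 using 2
    by_cases hl : T.IsLeading i
    · rw [if_pos hl]
      have hx : |T.flow i| = |T.q i| / T.k := by rw [hl.flow_eq, abs_div, abs_of_pos hk]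
      have hle := ((T.isLeading_iff i).mp hl).2
      rw [hl.flow_eq]
      have hw' : (edgeWeight (T.q i / T.k) : ℂ) = if |T.q i| < T.k / 2 then 1 else 1 / 2 := by
        rw [edgeWeight, ← hl.flow_eq]
        have : |T.flow i| < 1 / 2 ↔ |T.q i| < T.k / 2 := by
          rw [hx, div_lt_iff₀ hk, one_div, inv_mul_eq_div]
        by_cases h : |T.flow i| < 1 / 2
        · rw [if_pos h, if_pos (this.mp h)]; simp
        · rw [if_neg h, if_neg (fun h' => h (this.mpr h')), if_pos (le_antisymm hle (not_lt.mp h))]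
          simp
      push_cast
      rw [hw', mul_comm, mul_comm _ (Complex.exp _), mul_assoc]
      congr 2; ring
    · rw [if_neg hl]
      have : ¬ |T.flow i| ≤ 1 / 2 := fun h => hl ((T.isLeading_iff i).mpr ⟨h0.symm, h⟩)
      rw [edgeWeight, if_neg (fun h => this h.le), if_neg (fun h => this h.le)]
      simp
  · have hl : ¬ T.IsLeading i := fun h => h0.ne' ((T.isLeading_iff i).mp h).1
    rw [if_neg hl, mul_zero]
    have h2 : Tendsto (fun a => Complex.exp (-w a * T.reducedDim i)) l (𝓝 0) := by
      rw [tendsto_zero_iff_norm_tendsto_zero]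
      simp only [Complex.norm_exp_neg_mul_ofReal]
      refine Real.tendsto_exp_atBot.comp ?_
      simp only [neg_mul]
      exact tendsto_neg_atTop_atBot.comp (hw.atTop_mul_const h0)
    simpa using h2.mul h1

/-- The leading asymptotics of the dual channel. -/
theorem tendsto_sqrt_mul_tsum_dualTerm (T : UnitaryU1CFT H ι) (Q : ℤ) {α : Type*} {l : Filter α}
    [l.IsCountablyGenerated] {w : α → ℂ} (hw : Tendsto (fun a => (w a).re) l atTop)
    (hw1 : Tendsto (fun a => w a / (w a).re) l (𝓝 1)) :
    Tendsto (fun a => (√(w a).re : ℂ) * ∑' i, T.dualTerm Q (w a) i) l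
      (𝓝 (√(Real.pi / T.k) * T.leadingCoeff Q)) := by
  classical
  obtain ⟨K, hK, hb⟩ := T.exists_sqrt_mul_dualWeight_le
  have hfin : {i | T.IsLeading i}.Finite := by
    refine (T.finite_dim_le (T.k / 4)).subset fun i hi => ?_
    have hk := T.k_pos
    obtain ⟨h1, h2, h3⟩ := (hi : T.IsLeading i)
    rw [← h2, sub_eq_zero] at h1
    simp only [Set.mem_ofPred_eq, h1]
    rw [div_le_iff₀ (by positivity)]
    nlinarith [sq_abs (T.q i), abs_nonneg (T.q i)]
  have hlim : (√(Real.pi / T.k) : ℂ) * T.leadingCoeff Q = ∑' i, (√(Real.pi / T.k) : ℂ) *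
      if T.IsLeading i then (if |T.q i| < T.k / 2 then 1 else 1 / 2) *
      Complex.exp (-(2 * Real.pi * Complex.I * T.q i * Q / T.k)) else 0 := by
    rw [tsum_mul_left, leadingCoeff, tsum_eq_finsum]
    · simp only [finsum_eq_if]
    · refine hfin.subset fun i hi => ?_
      by_contra h
      exact hi (if_neg h)
  rw [hlim]
  simp only [← tsum_mul_left]
  refine tendsto_tsum_of_dominated_convergence (bound := fun i => K * Real.exp (-(1 / 4) * T.dim i))
    ((T.summable_exp_dim (by norm_num)).mul_left K)
    (fun i => T.tendsto_sqrt_mul_dualTerm Q hw hw1 i) ?_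
  filter_upwards [hw.eventually_ge_atTop 1] with a ha i
  rw [norm_mul, Complex.norm_real, Real.norm_of_nonneg (Real.sqrt_nonneg _)]
  exact le_trans (by gcongr; exact T.norm_dualTerm_le Q _ i) (hb _ ha i)

end UnitaryU1CFT

/-! ### Fourier inversion and the smoothed count as a contour integral. -/

open scoped FourierTransform in
theorem bandFourier_eq_fourierInv (φ : ℝ → ℝ) (t : ℝ) :
    bandFourier φ t = 1 / (2 * Real.pi) * 𝓕⁻ (fun x => (φ x : ℂ)) (t / (2 * Real.pi)) := by
  rw [bandFourier, Real.fourierInv_eq']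
  congr 2
  ext x
  rw [smul_eq_mul, mul_comm]
  congr 2
  simp only [RCLike.inner_apply, conj_trivial]
  push_cast
  have : (Real.pi : ℂ) ≠ 0 := Complex.ofReal_ne_zero.mpr Real.pi_ne_zero
  field_simp

theorem continuous_bandFourier {φ : ℝ → ℝ} (hφ : Integrable φ) : Continuous (bandFourier φ) := by
  have h : bandFourier φ = fun t : ℝ => 1 / (2 * Real.pi) *
      ∫ x : ℝ, (φ x : ℂ) * Complex.exp (Complex.I * t * x) := rfl
  rw [h]
  refine continuous_const.mul (continuous_of_dominated (bound := fun x => ‖φ x‖) (fun t => ?_)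
    (fun t => Eventually.of_forall fun x => ?_) hφ.norm (Eventually.of_forall fun x => ?_))
  · exact hφ.ofReal.aestronglyMeasurable.mul (Continuous.aestronglyMeasurable (by fun_prop))
  · rw [norm_mul, Complex.norm_real, Complex.norm_exp]; simp
  · fun_prop

theorem IsBandlimited.mono {Λ Λ' : ℝ} {φ : ℝ → ℝ} (h : IsBandlimited Λ φ) (hΛ : Λ ≤ Λ') :
    IsBandlimited Λ' φ := ⟨h.continuous, h.integrable, fun t ht => h.support t (hΛ.trans_lt ht)⟩

theorem IsBandlimited.hasCompactSupport {Λ : ℝ} {φ : ℝ → ℝ} (h : IsBandlimited Λ φ) :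
    HasCompactSupport (bandFourier φ) :=
  HasCompactSupport.intro (isCompact_Icc (a := -Λ) (b := Λ)) fun t ht => h.support t (by
    by_contra hc
    exact ht (abs_le.mp (not_lt.mp hc)))

theorem IsBandlimited.integrable_bandFourier {Λ : ℝ} {φ : ℝ → ℝ} (h : IsBandlimited Λ φ) :
    Integrable (bandFourier φ) :=
  (continuous_bandFourier h.integrable).integrable_of_hasCompactSupport h.hasCompactSupport

open scoped FourierTransform in
theorem IsBandlimited.inversion {Λ : ℝ} {φ : ℝ → ℝ} (h : IsBandlimited Λ φ) (x : ℝ) :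
    ∫ t : ℝ, bandFourier φ t * Complex.exp (-(Complex.I * t * x)) = φ x := by
  have hpi := Real.pi_pos
  have hint : Integrable (𝓕⁻ (fun x => (φ x : ℂ))) := by
    have h1 := h.integrable_bandFourier.const_mul (2 * Real.pi : ℂ)
    have h2 := h1.comp_mul_right' (R := 2 * Real.pi) (by positivity)
    refine h2.congr (Eventually.of_forall fun v => ?_)
    simp only [bandFourier_eq_fourierInv]
    have : (Real.pi : ℂ) ≠ 0 := Complex.ofReal_ne_zero.mpr Real.pi_ne_zero
    rw [mul_div_assoc, div_self (by positivity), mul_one]; field_simp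
  have hint' : Integrable (𝓕 (fun x => (φ x : ℂ))) := by
    refine hint.comp_neg.congr (Eventually.of_forall fun v => ?_)
    simp [Real.fourierInv_eq_fourier_neg]
  have h1 := congrFun (Continuous.fourier_fourierInv_eq (f := fun x => (φ x : ℂ))
    (by have := h.continuous; fun_prop) h.integrable.ofReal hint') x
  rw [Real.fourier_eq'] at h1
  rw [← h1]
  have h3 := Measure.integral_comp_div (fun v : ℝ =>
    Complex.exp (((-2 * Real.pi * inner ℝ v x : ℝ) : ℂ) * Complex.I) • 𝓕⁻ (fun x => (φ x : ℂ)) v)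
    (2 * Real.pi)
  rw [abs_of_pos (by positivity)] at h3
  have h4 : ∀ y : ℂ, y = ((1 / (2 * Real.pi) : ℝ) : ℂ) * (((2 * Real.pi : ℝ)) • y) := by
    intro y
    rw [Complex.real_smul, ← mul_assoc, ← Complex.ofReal_mul, one_div, inv_mul_cancel₀
      (by positivity), Complex.ofReal_one, one_mul]
  rw [h4 (∫ v : ℝ, Complex.exp _ • _), ← h3, ← integral_const_mul]
  congr 1
  ext t
  rw [bandFourier_eq_fourierInv, smul_eq_mul]
  simp only [RCLike.inner_apply, conj_trivial]
  push_cast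
  rw [mul_assoc, mul_comm (Complex.exp (-2 * Real.pi * _ * _))]
  congr 3
  have : (Real.pi : ℂ) ≠ 0 := Complex.ofReal_ne_zero.mpr Real.pi_ne_zero
  field_simp

namespace UnitaryU1CFT

variable {H : Type*} [NormedAddCommGroup H] [InnerProductSpace ℂ H] {ι : Type*}

open Classical in
/-- The sum of `e^{-βΔ'} φ(Δ' - Δ)` over the states of charge `Q`. -/
def windowSum (T : UnitaryU1CFT H ι) (Q : ℤ) (φ : ℝ → ℝ) (β Δ : ℝ) : ℝ :=
  ∑' i, if T.charge i = Q then Real.exp (-β * T.dim i) * φ (T.dim i - Δ) else 0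

theorem differentiableOn_chargeZ (T : UnitaryU1CFT H ι) (Q : ℤ) :
    DifferentiableOn ℂ (T.chargeZ Q) {z | 0 < z.re} := by
  classical
  have h := differentiableOn_tsum_exp_neg_mul (E := T.dim)
    (a := fun i => if T.charge i = Q then 1 else 0) T.dim_nonneg
    (fun s hs => T.summable_exp_dim hs) (fun i => by split_ifs <;> simp)
  refine h.congr fun z _ => tsum_congr fun i => ?_
  split_ifs <;> simp

/-- Write `φ` by Fourier inversion and exchange sum and integral: the phase `e^{-it(Δ'-Δ)}` moves
the temperature to `β + it`. -/
theorem windowSum_eq_integral (T : UnitaryU1CFT H ι) (Q : ℤ) {Λ : ℝ} {φ : ℝ → ℝ}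
    (hφ : IsBandlimited Λ φ) {β : ℝ} (hβ : 0 < β) (Δ : ℝ) :
    (T.windowSum Q φ β Δ : ℂ) =
      ∫ t : ℝ, bandFourier φ t * Complex.exp (Complex.I * t * Δ) *
        T.chargeZ Q (β + Complex.I * t) := by
  classical
  have := T.countable_index
  set F : ι → ℝ → ℂ := fun i t => if T.charge i = Q then bandFourier φ t *
    Complex.exp (Complex.I * t * Δ) * Complex.exp (-(β + Complex.I * t) * T.dim i) else 0
  have hre : ∀ t : ℝ, (β + Complex.I * t : ℂ).re = β := fun t => by simp
  have hb : ∀ i t, ‖F i t‖ ≤ ‖bandFourier φ t‖ * Real.exp (-β * T.dim i) := by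
    intro i t
    simp only [F]
    split_ifs
    · rw [norm_mul, norm_mul, Complex.norm_exp_neg_mul_ofReal, hre, Complex.norm_exp]; simp
    · simp only [norm_zero]; positivity
  have h := hasSum_integral_of_dominated_convergence (μ := volume) (F := F)
    (f := fun t => ∑' i, F i t) (fun i t => ‖bandFourier φ t‖ * Real.exp (-β * T.dim i))
    (fun i => by
      have := continuous_bandFourier hφ.integrable
      refine Continuous.aestronglyMeasurable ?_
      by_cases hi : T.charge i = Q
      · simp only [F, if_pos hi]; fun_prop
      · simp only [F, if_neg hi]; fun_prop)
    (fun i => Eventually.of_forall (hb i))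
    (Eventually.of_forall fun t => (T.summable_exp_dim hβ).mul_left _)
    (by simp only [tsum_mul_left]; exact hφ.integrable_bandFourier.norm.mul_const _)
    (Eventually.of_forall fun t => (Summable.of_norm_bounded
      ((T.summable_exp_dim hβ).mul_left _) (fun i => hb i t)).hasSum)
  have e1 : ∀ t : ℝ, bandFourier φ t * Complex.exp (Complex.I * t * Δ) *
        T.chargeZ Q (β + Complex.I * t) = ∑' i, F i t := by
    intro t
    rw [chargeZ, ← tsum_mul_left]
    refine tsum_congr fun i => ?_
    simp only [F]
    split_ifs <;> simp
  simp only [e1]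
  rw [← h.tsum_eq, windowSum, Complex.ofReal_tsum]
  refine tsum_congr fun i => ?_
  simp only [F]
  split_ifs with hi
  · rw [Complex.ofReal_mul, ← hφ.inversion, ← integral_const_mul]
    congr 1
    ext t
    rw [Complex.ofReal_exp, mul_left_comm, ← Complex.exp_add, mul_assoc (bandFourier φ t), ← Complex.exp_add]
    congr 2
    push_cast; ring
  · simp

end UnitaryU1CFT

/-! ### The saddle point. -/

/-- From `x⁴/4! ≤ e^x`. The far region produces four powers of `β⁻¹`: one from the prefactor
`β^{-1/2} ≤ β⁻¹` and three from `1 + u²`. -/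
theorem exp_neg_div_mul_inv_pow_four_le {ε β : ℝ} (hε : 0 < ε) (hβ : 0 < β) :
    Real.exp (-(ε / β)) * β⁻¹ ^ 4 ≤ 24 / ε ^ 4 := by
  have h := Real.pow_div_factorial_le_exp (ε / β) (by positivity) 4
  rw [Real.exp_neg, inv_mul_le_iff₀ (Real.exp_pos _)]
  calc β⁻¹ ^ 4 = ((ε / β) ^ 4 / (Nat.factorial 4)) * (24 / ε ^ 4) := by
        norm_num [Nat.factorial]; field_simp
    _ ≤ _ := by gcongr

namespace UnitaryU1CFT

variable {H : Type*} [NormedAddCommGroup H] [InnerProductSpace ℂ H] {ι : Type*}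

/-- The integrand of the inverse Laplace transform of the charge-`Q` partition function near the
saddle, in the variable `u = t / β^{3/2}`. -/
def saddleIntegrand (T : UnitaryU1CFT H ι) (Q : ℤ) (φ : ℝ → ℝ) (β u : ℝ) : ℂ :=
  (√β : ℂ)⁻¹ * Real.exp (-(Real.pi ^ 2 * T.c / 3 / β)) *
    (bandFourier φ (β * √β * u) *
      Complex.exp (Complex.I * ((β * √β * u : ℝ) : ℂ) * ((Real.pi ^ 2 * T.c / 3 / β ^ 2 : ℝ) : ℂ)) *
      T.chargeZ Q (β + Complex.I * ((β * √β * u : ℝ) : ℂ)))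

theorem integral_saddleIntegrand (T : UnitaryU1CFT H ι) (Q : ℤ) {Λ : ℝ} {φ : ℝ → ℝ}
    (hφ : IsBandlimited Λ φ) {β : ℝ} (hβ : 0 < β) :
    ∫ u : ℝ, T.saddleIntegrand Q φ β u =
      ((β⁻¹ ^ 2 * Real.exp (-(Real.pi ^ 2 * T.c / 3 / β)) *
        T.windowSum Q φ β (Real.pi ^ 2 * T.c / 3 / β ^ 2) : ℝ) : ℂ) := by
  have hs : 0 < √β := Real.sqrt_pos.mpr hβ
  simp only [saddleIntegrand]
  rw [integral_const_mul, Measure.integral_comp_mul_left (fun t : ℝ => bandFourier φ t *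
      Complex.exp (Complex.I * (t : ℂ) * ((Real.pi ^ 2 * T.c / 3 / β ^ 2 : ℝ) : ℂ)) *
      T.chargeZ Q (β + Complex.I * (t : ℂ))) (β * √β), ← T.windowSum_eq_integral Q hφ hβ,
      abs_of_pos (by positivity), Complex.real_smul]
  have h2 : (√β : ℂ) * √β = β := by rw [← Complex.ofReal_mul, Real.mul_self_sqrt hβ.le]
  have h3 : (√β : ℂ)⁻¹ * ((β : ℂ) * √β)⁻¹ = (β : ℂ)⁻¹ ^ 2 := by
    rw [← mul_inv, mul_left_comm, h2, inv_pow, sq]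
  push_cast
  rw [← h3]; ring

/-- With `τ = √β u` and `A = π²c/3`, the exponents `-A/β`, `itΔ = iτA/β` and `(4π²/z)c/12 = (A/β)/(1
+ iτ)` add up to `-Au²/(1 + iτ)`: the linear term cancels by the choice `Δ = A/β²`. The rest is
normalised so that `√Re w` multiplies the dual sum. -/
theorem saddleIntegrand_eq {T : UnitaryU1CFT H ι} (hF : T.IsFaithfulCompact)
    (hT : T.IsModularCovariant) (Q : ℤ) (φ : ℝ → ℝ) {β : ℝ} (hβ : 0 < β) (u : ℝ) {z : ℂ}
    (hz : z = β + Complex.I * ((β * √β * u : ℝ) : ℂ)) :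
    T.saddleIntegrand Q φ β u = bandFourier φ (β * √β * u) *
      Complex.exp (-((Real.pi ^ 2 * T.c / 3 * u ^ 2 : ℝ) : ℂ) / (1 + Complex.I * (√β * u : ℝ))) *
      Complex.exp (-z * (T.c / 12 : ℝ)) *
      ((√(1 + β * u ^ 2) / (2 * Real.pi) : ℝ) *
        ((√(4 * Real.pi ^ 2 / z).re : ℂ) * ∑' i, T.dualTerm Q (4 * Real.pi ^ 2 / z) i)) := by
  have hs : 0 < √β := Real.sqrt_pos.mpr hβ
  have hpi := Real.pi_pos
  have hss : √β ^ 2 = β := Real.sq_sqrt hβ.le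
  have hre : z.re = β := by rw [hz]; simp
  have him : z.im = β * √β * u := by rw [hz]; simp
  have hz0 : 0 < z.re := hre ▸ hβ
  have hzne : z ≠ 0 := by rintro rfl; simp at hz0
  have hw : (4 * Real.pi ^ 2 / z).re = 4 * Real.pi ^ 2 / (β * (1 + β * u ^ 2)) := by
    rw [Complex.four_pi_sq_div_re, Complex.normSq_apply, hre, him,
      show β * β + β * √β * u * (β * √β * u) = β * (β * (1 + √β ^ 2 * u ^ 2)) by ring, hss]
    field_simp
  have hpos : 0 < 1 + β * u ^ 2 := by positivity
  have hsw : √(4 * Real.pi ^ 2 / z).re = 2 * Real.pi / (√β * √(1 + β * u ^ 2)) := by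
    rw [hw, ← Real.sqrt_mul hβ.le, Real.sqrt_div (by positivity),
      show 4 * Real.pi ^ 2 = (2 * Real.pi) ^ 2 by ring, Real.sqrt_sq (by positivity)]
  have hc : T.chargeZ Q z = Complex.exp (-z * (T.c / 12 : ℝ)) *
      (Complex.exp ((4 * Real.pi ^ 2 / z) * (T.c / 12)) *
        ∑' i, T.dualTerm Q (4 * Real.pi ^ 2 / z) i) := by
    rw [← hT.chargeZ_eq hF Q hz0, ← mul_assoc, ← Complex.exp_add]
    push_cast
    rw [neg_mul, neg_add_cancel, Complex.exp_zero, one_mul]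
  have h1 : (1 + Complex.I * (√β * u : ℝ) : ℂ) = z / β := by
    rw [hz, eq_div_iff (Complex.ofReal_ne_zero.mpr hβ.ne')]; push_cast; ring
  have hexp : -((Real.pi ^ 2 * T.c / 3 * u ^ 2 : ℝ) : ℂ) / (1 + Complex.I * (√β * u : ℝ)) =
      ((-(Real.pi ^ 2 * T.c / 3 / β) : ℝ) : ℂ) +
        Complex.I * ((β * √β * u : ℝ) : ℂ) * ((Real.pi ^ 2 * T.c / 3 / β ^ 2 : ℝ) : ℂ) +
        (4 * Real.pi ^ 2 / z) * (T.c / 12) := by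
    have hb0 : (β : ℂ) ≠ 0 := Complex.ofReal_ne_zero.mpr hβ.ne'
    have hss' : (√β : ℂ) ^ 2 = β := by rw [← Complex.ofReal_pow, hss]
    have hz1 : z = β * (1 + Complex.I * √β * u) := by rw [hz]; push_cast; ring
    have hy : (Complex.I * √β * u) ^ 2 = -(β * u ^ 2 : ℂ) := by
      rw [mul_pow, mul_pow, Complex.I_sq, hss']; ring
    have hne : (1 + Complex.I * √β * u : ℂ) ≠ 0 := by
      intro h; rw [h, mul_zero] at hz1; exact hzne hz1
    have e1 : Complex.I * ((β * √β * u : ℝ) : ℂ) = β * (Complex.I * √β * u) := by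
      push_cast; ring
    have e2 : Complex.I * ((√β * u : ℝ) : ℂ) = Complex.I * √β * u := by push_cast; ring
    rw [hz1, e1, e2]
    generalize (Complex.I * √β * u : ℂ) = y at *
    push_cast
    field_simp
    linear_combination (-12 * T.c : ℂ) * hy
  rw [hexp, Complex.exp_add, Complex.exp_add, saddleIntegrand, ← hz, hc, hsw]
  have h4 : (√β : ℂ)⁻¹ = ((√(1 + β * u ^ 2) / (2 * Real.pi) : ℝ) : ℂ) *
      ((2 * Real.pi / (√β * √(1 + β * u ^ 2)) : ℝ) : ℂ) := by
    rw [← Complex.ofReal_mul, ← Complex.ofReal_inv]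
    congr 1
    have := Real.sqrt_pos.mpr hpos
    field_simp
  rw [h4, Complex.ofReal_exp]
  ring

end UnitaryU1CFT

theorem Complex.four_pi_sq_div_saddle_re {β : ℝ} (hβ : 0 < β) (u : ℝ) :
    (4 * Real.pi ^ 2 / (β + Complex.I * ((β * √β * u : ℝ) : ℂ))).re =
      4 * Real.pi ^ 2 / (β * (1 + β * u ^ 2)) := by
  have hs : 0 < √β := Real.sqrt_pos.mpr hβ
  have hss : √β ^ 2 = β := Real.sq_sqrt hβ.le
  have hre : (β + Complex.I * ((β * √β * u : ℝ) : ℂ)).re = β := by simp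
  have him : (β + Complex.I * ((β * √β * u : ℝ) : ℂ)).im = β * √β * u := by simp
  rw [Complex.four_pi_sq_div_re, Complex.normSq_apply, hre, him,
    show β * β + β * √β * u * (β * √β * u) = β * (β * (1 + √β ^ 2 * u ^ 2)) by ring, hss]
  field_simp

/-- Bookkeeping for the far region: `r = β^{-1/2}`, `P = e^{-A/β}`, `M` bounds `φ̂`, `Z` is the norm
of the partition function, `S` the sum of exponentials bounding it, `e = e^{-ε/β}`, `b = β⁻¹` and `v
= 1 + u²`. -/
theorem mul_le_of_far_bounds {N r P M Z C S e E b L v D : ℝ} (hM : 0 ≤ M) (hC : 0 ≤ C)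
    (hr0 : 0 ≤ r) (hP : 0 ≤ P) (he : 0 ≤ e) (hE : 0 ≤ E) (hb : 0 ≤ b) (hL : 0 ≤ L) (hv0 : 0 ≤ v)
    (hN : N ≤ r * P * (M * Z)) (hZ : Z ≤ C * S) (hPS : P * S ≤ e * E) (hr : r ≤ b)
    (hv : v ≤ L * b ^ 3) (hD : e * b ^ 4 ≤ D) : N * v ≤ M * (C * E) * (L * D) :=
  calc N * v ≤ (r * P * (M * (C * S))) * v := by
        refine mul_le_mul_of_nonneg_right (hN.trans ?_) hv0
        gcongr
    _ = M * C * r * (P * S) * v := by ring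
    _ ≤ M * C * r * (e * E) * v := by gcongr
    _ ≤ M * C * b * (e * E) * (L * b ^ 3) := by gcongr
    _ = M * (C * E) * (L * (e * b ^ 4)) := by ring
    _ ≤ _ := by gcongr

namespace UnitaryU1CFT

variable {H : Type*} [NormedAddCommGroup H] [InnerProductSpace ℂ H] {ι : Type*}

theorem continuous_saddleIntegrand (T : UnitaryU1CFT H ι) (Q : ℤ) {φ : ℝ → ℝ}
    (hφ : Integrable φ) {β : ℝ} (hβ : 0 < β) : Continuous (T.saddleIntegrand Q φ β) := by
  have h1 := continuous_bandFourier hφ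
  have h2 : Continuous fun u : ℝ => T.chargeZ Q (β + Complex.I * ((β * √β * u : ℝ) : ℂ)) := by
    refine (T.differentiableOn_chargeZ Q).continuousOn.comp_continuous (by fun_prop) fun u => ?_
    simpa using hβ
  unfold saddleIntegrand
  exact continuous_const.mul (((h1.comp (by fun_prop)).mul (by fun_prop)).mul h2)

theorem tendsto_saddleIntegrand {T : UnitaryU1CFT H ι} (hF : T.IsFaithfulCompact)
    (hT : T.IsModularCovariant) (Q : ℤ) {φ : ℝ → ℝ} (hφ : Integrable φ) (u : ℝ) :
    Tendsto (fun β => T.saddleIntegrand Q φ β u) (𝓝[>] 0)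
      (𝓝 (bandFourier φ 0 * Real.exp (-(Real.pi ^ 2 * T.c / 3) * u ^ 2) *
        (1 / (2 * Real.pi) * (√(Real.pi / T.k) * T.leadingCoeff Q)))) := by
  have hpi := Real.pi_pos
  have hpos : ∀ᶠ β : ℝ in 𝓝[>] 0, 0 < β := self_mem_nhdsWithin
  have hlim : ∀ f : ℝ → ℂ, Continuous f → Tendsto f (𝓝[>] 0) (𝓝 (f 0)) :=
    fun f hf => (hf.tendsto 0).mono_left nhdsWithin_le_nhds
  have hne : ∀ β : ℝ, (1 + Complex.I * ((√β * u : ℝ) : ℂ)) ≠ 0 := by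
    intro β h
    have := congrArg Complex.re h
    simp at this
  have hw : Tendsto (fun β : ℝ => (4 * Real.pi ^ 2 / (β + Complex.I * ((β * √β * u : ℝ) : ℂ))).re)
      (𝓝[>] 0) atTop := by
    have h1 : Tendsto (fun β : ℝ => β * (1 + β * u ^ 2)) (𝓝[>] 0) (𝓝[>] 0) := by
      refine tendsto_nhdsWithin_iff.mpr ⟨?_, ?_⟩
      · have : Continuous fun β : ℝ => β * (1 + β * u ^ 2) := by fun_prop
        simpa using (this.tendsto 0).mono_left nhdsWithin_le_nhds
      · filter_upwards [hpos] with β hβ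
        simp only [Set.mem_Ioi]; positivity
    refine ((tendsto_inv_nhdsGT_zero.comp h1).const_mul_atTop
      (show 0 < 4 * Real.pi ^ 2 by positivity)).congr' ?_
    filter_upwards [hpos] with β hβ
    rw [Complex.four_pi_sq_div_saddle_re hβ, div_eq_mul_inv]; rfl
  have hw1 : Tendsto (fun β : ℝ => (4 * Real.pi ^ 2 / (β + Complex.I * ((β * √β * u : ℝ) : ℂ))) /
      ((4 * Real.pi ^ 2 / (β + Complex.I * ((β * √β * u : ℝ) : ℂ))).re : ℂ)) (𝓝[>] 0) (𝓝 1) := by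
    have h1 := hlim (fun β : ℝ => ((1 + β * u ^ 2 : ℝ) : ℂ) / (1 + Complex.I * ((√β * u : ℝ) : ℂ)))
      (by
        refine Continuous.div (by fun_prop) ?_ hne
        have := Real.continuous_sqrt
        fun_prop)
    simp only [zero_mul, add_zero, Real.sqrt_zero, Complex.ofReal_zero, mul_zero, div_one,
      Complex.ofReal_one] at h1
    refine h1.congr' ?_
    filter_upwards [hpos] with β hβ
    rw [Complex.four_pi_sq_div_saddle_re hβ]
    have hb0 : (β : ℂ) ≠ 0 := Complex.ofReal_ne_zero.mpr hβ.ne'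
    have e : (β + Complex.I * ((β * √β * u : ℝ) : ℂ)) =
        β * (1 + Complex.I * ((√β * u : ℝ) : ℂ)) := by push_cast; ring
    have hpi0 : (Real.pi : ℂ) ≠ 0 := Complex.ofReal_ne_zero.mpr hpi.ne'
    have h3 : (1 + β * u ^ 2 : ℂ) ≠ 0 := by
      have : (0 : ℝ) < 1 + β * u ^ 2 := by positivity
      exact_mod_cast this.ne'
    rw [e]
    have := hne β
    push_cast at this ⊢
    rw [div_div_div_eq, div_eq_div_iff this
      (mul_ne_zero (mul_ne_zero hb0 this) (by simp [hpi0]))]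
    ring
  have hmain := T.tendsto_sqrt_mul_tsum_dualTerm Q hw hw1
  have h1 := hlim (fun β => bandFourier φ (β * √β * u)) (by
    have := Real.continuous_sqrt
    exact (continuous_bandFourier hφ).comp (by fun_prop))
  have h2 := hlim (fun β => Complex.exp (-((Real.pi ^ 2 * T.c / 3 * u ^ 2 : ℝ) : ℂ) /
      (1 + Complex.I * (√β * u : ℝ)))) (by
    have := Real.continuous_sqrt
    exact Complex.continuous_exp.comp (Continuous.div (by fun_prop) (by fun_prop) hne))
  have h3 := hlim (fun β => Complex.exp (-(β + Complex.I * ((β * √β * u : ℝ) : ℂ)) *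
      (T.c / 12 : ℝ))) (by
    have := Real.continuous_sqrt
    fun_prop)
  have h4 := hlim (fun β => ((√(1 + β * u ^ 2) / (2 * Real.pi) : ℝ) : ℂ)) (by fun_prop)
  have h5 := ((h1.mul h2).mul h3).mul (h4.mul hmain)
  have e : (bandFourier φ 0 * Real.exp (-(Real.pi ^ 2 * T.c / 3) * u ^ 2) *
        (1 / (2 * Real.pi) * (√(Real.pi / T.k) * T.leadingCoeff Q)) : ℂ) =
      bandFourier φ (0 * √0 * u) * Complex.exp (-((Real.pi ^ 2 * T.c / 3 * u ^ 2 : ℝ) : ℂ) /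
      (1 + Complex.I * (√0 * u : ℝ))) * Complex.exp (-(((0 : ℝ) : ℂ) +
        Complex.I * ((0 * √0 * u : ℝ) : ℂ)) * (T.c / 12 : ℝ)) *
      (((√(1 + 0 * u ^ 2) / (2 * Real.pi) : ℝ) : ℂ) * (√(Real.pi / T.k) * T.leadingCoeff Q)) := by
    simp
  rw [e]
  refine h5.congr' ?_
  filter_upwards [hpos] with β hβ
  exact (saddleIntegrand_eq hF hT Q φ hβ u rfl).symm

/-- The integrable majorant, uniform in `β ≤ 1`, that justifies passing to the limit: a Gaussian
near the saddle and `(1 + u²)⁻¹` away from it. -/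
theorem exists_norm_saddleIntegrand_le {T : UnitaryU1CFT H ι} (hF : T.IsFaithfulCompact)
    (hT : T.IsModularCovariant) (Q : ℤ) {Λ : ℝ} (hΛ0 : 0 ≤ Λ) (hΛ : Λ < 2 * Real.pi) {φ : ℝ → ℝ}
    (hφ : IsBandlimited Λ φ) : ∃ K₁ K₂ : ℝ, ∀ β : ℝ, 0 < β → β ≤ 1 → ∀ u : ℝ,
      ‖T.saddleIntegrand Q φ β u‖ ≤ K₁ * Real.exp (-(Real.pi ^ 2 * T.c / 6) * u ^ 2) +
        K₂ * (1 + u ^ 2)⁻¹ := by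
  have hpi := Real.pi_pos
  have hpi3 := Real.pi_gt_three
  have hc := T.c_pos
  obtain ⟨M, hM⟩ := hφ.hasCompactSupport.exists_bound_of_continuous
    (continuous_bandFourier hφ.integrable)
  have hM0 : 0 ≤ M := (norm_nonneg _).trans (hM 0)
  obtain ⟨K, hK, hKb⟩ := T.exists_sqrt_mul_norm_tsum_dualTerm_le
  obtain ⟨C, hC, hCb⟩ := exists_norm_chargeZ_le hF hT
  -- The two entries are the gaps, times `β`, between `A/β` and the two exponents of
  -- `exists_norm_chargeZ_le`; the second is positive because `Λ < 2π`.
  set ε := min (Real.pi ^ 2 * T.c / 6) (T.c / 12 * (4 * Real.pi ^ 2 - Λ ^ 2)) with hε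
  have hε0 : 0 < ε := lt_min (by positivity) (mul_pos (by positivity) (by nlinarith))
  refine ⟨M * K, M * (C * (1 + Real.exp (T.c / 12))) * ((1 + Λ ^ 2) * (24 / ε ^ 4)),
    fun β hβ hβ1 u => ?_⟩
  have hs : 0 < √β := Real.sqrt_pos.mpr hβ
  have hss : √β ^ 2 = β := Real.sq_sqrt hβ.le
  set z : ℂ := β + Complex.I * ((β * √β * u : ℝ) : ℂ) with hz
  have hre : z.re = β := by simp [hz]
  have hwre : (4 * Real.pi ^ 2 / z).re = 4 * Real.pi ^ 2 / (β * (1 + β * u ^ 2)) :=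
    Complex.four_pi_sq_div_saddle_re hβ u
  have hDc : ‖Complex.exp (-z * (T.c / 12 : ℝ))‖ ≤ 1 := by
    rw [Complex.norm_exp_neg_mul_ofReal, hre, Real.exp_le_one_iff]
    have : 0 ≤ β * (T.c / 12) := by positivity
    linarith
  -- The split is at `|t| = β`. Below it `Re w ≥ 2π²/β ≥ 1`, so the `O(1/√Re w)` bound applies, and
  -- `Re 1/(1 + i√β u) ≥ 1/2` keeps half of the Gaussian decay.
  rcases le_total (β * u ^ 2) 1 with hτ | hτ
  · refine le_add_of_le_of_nonneg ?_ (by positivity)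
    rw [saddleIntegrand_eq hF hT Q φ hβ u hz, norm_mul, norm_mul, norm_mul]
    have hw1 : 1 ≤ (4 * Real.pi ^ 2 / z).re := by
      rw [hwre, le_div_iff₀ (by positivity)]
      nlinarith
    have h1 : ‖Complex.exp (-((Real.pi ^ 2 * T.c / 3 * u ^ 2 : ℝ) : ℂ) /
        (1 + Complex.I * (√β * u : ℝ)))‖ ≤ Real.exp (-(Real.pi ^ 2 * T.c / 6) * u ^ 2) := by
      rw [Complex.norm_exp, Real.exp_le_exp, ← Complex.ofReal_neg, div_eq_mul_inv,
        Complex.re_ofReal_mul, Complex.inv_re, Complex.normSq_apply]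
      simp only [Complex.add_re, Complex.one_re, Complex.mul_re, Complex.I_re, Complex.ofReal_re,
        zero_mul, Complex.I_im, Complex.ofReal_im, mul_zero, sub_zero, add_zero, Complex.add_im,
        Complex.one_im, Complex.mul_im, one_mul, zero_add, mul_one]
      rw [show √β * u * (√β * u) = √β ^ 2 * u ^ 2 by ring, hss]
      have h2 : 1 / 2 ≤ 1 / (1 + β * u ^ 2) := by
        apply one_div_le_one_div_of_le <;> nlinarith [sq_nonneg u]
      have h3 : 0 ≤ Real.pi ^ 2 * T.c / 3 * u ^ 2 := by positivity
      nlinarith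
    have h2 : ‖((√(1 + β * u ^ 2) / (2 * Real.pi) : ℝ) : ℂ)‖ ≤ 1 := by
      rw [Complex.norm_real, Real.norm_of_nonneg (by positivity), div_le_one (by positivity)]
      calc √(1 + β * u ^ 2) ≤ √(2 ^ 2) := Real.sqrt_le_sqrt (by linarith)
        _ = 2 := Real.sqrt_sq (by norm_num)
        _ ≤ _ := by linarith
    have h3 : ‖(√(4 * Real.pi ^ 2 / z).re : ℂ) * ∑' i, T.dualTerm Q (4 * Real.pi ^ 2 / z) i‖ ≤
        K := by
      rw [norm_mul, Complex.norm_real, Real.norm_of_nonneg (Real.sqrt_nonneg _)]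
      exact hKb Q _ hw1
    calc _ ≤ M * Real.exp (-(Real.pi ^ 2 * T.c / 6) * u ^ 2) * 1 * (‖((√(1 + β * u ^ 2) /
          (2 * Real.pi) : ℝ) : ℂ) * ((√(4 * Real.pi ^ 2 / z).re : ℂ) *
            ∑' i, T.dualTerm Q (4 * Real.pi ^ 2 / z) i)‖) := by
          rw [norm_mul]; gcongr; exact hM _
      _ ≤ M * Real.exp (-(Real.pi ^ 2 * T.c / 6) * u ^ 2) * 1 * (1 * K) := by
          rw [norm_mul]; gcongr
      _ = _ := by ring
  · refine le_add_of_nonneg_of_le (by positivity) ?_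
    -- Outside the band the integrand vanishes; inside it `t² = β³u² ≤ Λ²`, which also bounds `u` by
    -- a power of `β⁻¹`.
    by_cases ht : Λ < |β * √β * u|
    · rw [saddleIntegrand, hφ.support _ ht, zero_mul, zero_mul, mul_zero, norm_zero]
      have : 0 < ε ^ 4 := by positivity
      positivity
    rw [not_lt] at ht
    have ht2 : β ^ 3 * u ^ 2 ≤ Λ ^ 2 := by
      have := sq_le_sq' (by linarith [abs_nonneg (β * √β * u)]) ht
      rw [sq_abs, mul_pow, mul_pow, hss] at this
      linarith
    have hcz : ‖T.chargeZ Q z‖ ≤ C * (Real.exp ((4 * Real.pi ^ 2 / z).re * (T.c / 12)) +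
          Real.exp (4 * Real.pi ^ 2 / (4 * Real.pi ^ 2 / z).re * (T.c / 12))) := by
      have h := hCb Q z (hre ▸ hβ)
      refine le_trans (le_trans (le_of_eq ?_) (mul_le_mul hDc h (norm_nonneg _) one_pos.le))
        (one_mul _).le
      rw [← norm_mul, ← mul_assoc, ← Complex.exp_add]
      push_cast
      rw [neg_mul, neg_add_cancel, Complex.exp_zero, one_mul]
    have he1 : (4 * Real.pi ^ 2 / z).re * (T.c / 12) ≤ Real.pi ^ 2 * T.c / 3 / β - ε / β := by
      rw [hwre, ← sub_div, div_mul_eq_mul_div, div_le_div_iff₀ (by positivity) hβ]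
      have h1 : ε ≤ Real.pi ^ 2 * T.c / 6 := min_le_left _ _
      have h2 : Real.pi ^ 2 * T.c / 6 ≤ Real.pi ^ 2 * T.c / 3 - ε := by linarith
      calc _ = Real.pi ^ 2 * T.c / 6 * (β * (1 + 1)) := by ring
        _ ≤ _ := by gcongr; linarith [show 0 < Real.pi ^ 2 * T.c / 6 by positivity]
    -- Here `4π²/Re w = β + t²/β`, so the exponent is at most `(c/12)(Λ²/β + β)`, to be compared
    -- with `A/β = (c/12)4π²/β`.
    have he2 : 4 * Real.pi ^ 2 / (4 * Real.pi ^ 2 / z).re * (T.c / 12) ≤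
        Real.pi ^ 2 * T.c / 3 / β - ε / β + T.c / 12 := by
      have h1 : ε ≤ T.c / 12 * (4 * Real.pi ^ 2 - Λ ^ 2) := min_le_right _ _
      have h2 : 4 * Real.pi ^ 2 / (4 * Real.pi ^ 2 / z).re = β * (1 + β * u ^ 2) := by
        rw [hwre]; field_simp
      rw [h2, ← sub_div, ← sub_le_iff_le_add, le_div_iff₀ hβ]
      have h3 : T.c / 12 * (β ^ 3 * u ^ 2) ≤ T.c / 12 * Λ ^ 2 := by gcongr
      have h4 : T.c / 12 * β ^ 2 ≤ T.c / 12 * β := by gcongr; nlinarith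
      linarith
    have hnorm : ‖T.saddleIntegrand Q φ β u‖ ≤ (√β)⁻¹ *
        Real.exp (-(Real.pi ^ 2 * T.c / 3 / β)) * (M * ‖T.chargeZ Q z‖) := by
      rw [saddleIntegrand, norm_mul, norm_mul, norm_mul, norm_mul, norm_inv, Complex.norm_real,
        Complex.norm_real, Real.norm_of_nonneg hs.le, Real.norm_of_nonneg (Real.exp_pos _).le]
      have : ‖Complex.exp (Complex.I * ((β * √β * u : ℝ) : ℂ) *
          ((Real.pi ^ 2 * T.c / 3 / β ^ 2 : ℝ) : ℂ))‖ = 1 := by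
        rw [mul_assoc, ← Complex.ofReal_mul, Complex.norm_exp_I_mul_ofReal]
      rw [this, mul_one]
      gcongr
      exact hM _
    have hsb : (√β)⁻¹ ≤ β⁻¹ := by
      refine inv_anti₀ hβ (Real.le_sqrt_of_sq_le ?_)
      nlinarith
    have hu : 1 + u ^ 2 ≤ (1 + Λ ^ 2) * β⁻¹ ^ 3 := by
      rw [inv_pow, ← div_eq_mul_inv, le_div_iff₀ (by positivity)]
      nlinarith [pow_le_one₀ hβ.le hβ1 (n := 3)]
    have hsum : Real.exp (-(Real.pi ^ 2 * T.c / 3 / β)) *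
        (Real.exp ((4 * Real.pi ^ 2 / z).re * (T.c / 12)) +
          Real.exp (4 * Real.pi ^ 2 / (4 * Real.pi ^ 2 / z).re * (T.c / 12))) ≤
        Real.exp (-(ε / β)) * (1 + Real.exp (T.c / 12)) := by
      rw [mul_add, mul_add, ← Real.exp_add, ← Real.exp_add, mul_one, ← Real.exp_add]
      exact add_le_add (Real.exp_le_exp.mpr (by linarith)) (Real.exp_le_exp.mpr (by linarith))
    have hdec := exp_neg_div_mul_inv_pow_four_le hε0 hβ
    have hu0 : 0 < 1 + u ^ 2 := by positivity
    rw [← div_eq_mul_inv, le_div_iff₀ hu0]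
    exact mul_le_of_far_bounds hM0 hC.le (by positivity) (by positivity) (by positivity)
      (by positivity) (by positivity) (by positivity) hu0.le hnorm hcz hsum hsb hu hdec

/-- The saddle-point asymptotics of the smoothed density of states of charge `Q`. -/
theorem tendsto_windowSum {T : UnitaryU1CFT H ι} (hF : T.IsFaithfulCompact)
    (hT : T.IsModularCovariant) (Q : ℤ) (hN : T.leadingCoeff Q = 1) {Λ : ℝ}
    (hΛ : Λ < 2 * Real.pi) {φ : ℝ → ℝ} (hφ : IsBandlimited Λ φ) :
    Tendsto (fun β => β⁻¹ ^ 2 * Real.exp (-(Real.pi ^ 2 * T.c / 3 / β)) *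
        T.windowSum Q φ β (Real.pi ^ 2 * T.c / 3 / β ^ 2)) (𝓝[>] 0)
      (𝓝 ((bandFourier φ 0).re * (√(3 / (T.k * T.c)) / (2 * Real.pi)))) := by
  have hpi := Real.pi_pos
  have hc := T.c_pos
  have hk := T.k_pos
  -- `Λ` may be negative, whereas the domination lemma needs a nonnegative band.
  have hφ' := hφ.mono (le_max_left Λ 0)
  obtain ⟨K₁, K₂, hb⟩ := exists_norm_saddleIntegrand_le hF hT Q (le_max_right Λ 0)
    (max_lt hΛ (by positivity)) hφ'
  have hpos : ∀ᶠ β : ℝ in 𝓝[>] 0, 0 < β := self_mem_nhdsWithin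
  have hle : ∀ᶠ β : ℝ in 𝓝[>] 0, β ≤ 1 :=
    nhdsWithin_le_nhds ((eventually_le_nhds one_pos))
  have h := tendsto_integral_filter_of_dominated_convergence (l := 𝓝[>] (0 : ℝ)) (μ := volume)
    (F := fun β u => T.saddleIntegrand Q φ β u) (fun u =>
      K₁ * Real.exp (-(Real.pi ^ 2 * T.c / 6) * u ^ 2) + K₂ * (1 + u ^ 2)⁻¹)
    (by
      filter_upwards [hpos] with β hβ
      exact (T.continuous_saddleIntegrand Q hφ.integrable hβ).aestronglyMeasurable)
    (by
      filter_upwards [hpos, hle] with β hβ hβ1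
      exact Eventually.of_forall (hb β hβ hβ1))
    (((integrable_exp_neg_mul_sq (by positivity)).const_mul _).add
      (integrable_inv_one_add_sq.const_mul _))
    (Eventually.of_forall fun u => tendsto_saddleIntegrand hF hT Q hφ.integrable u)
  rw [hN, integral_mul_const, integral_const_mul, integral_complex_ofReal, integral_gaussian,
    mul_one] at h
  have h2 := (Complex.continuous_re.tendsto _).comp h
  have e : (bandFourier φ 0 * ((√(Real.pi / (Real.pi ^ 2 * T.c / 3)) : ℝ) : ℂ) *
      (1 / (2 * Real.pi) * (√(Real.pi / T.k) : ℝ))).re =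
      (bandFourier φ 0).re * (√(3 / (T.k * T.c)) / (2 * Real.pi)) := by
    have e1 : √(Real.pi / (Real.pi ^ 2 * T.c / 3)) * √(Real.pi / T.k) = √(3 / (T.k * T.c)) := by
      rw [← Real.sqrt_mul (by positivity)]
      congr 1; field_simp
    rw [← e1, show (1 / (2 * Real.pi) * (√(Real.pi / T.k) : ℝ) : ℂ) =
      ((1 / (2 * Real.pi) * √(Real.pi / T.k) : ℝ) : ℂ) by push_cast; ring, mul_assoc,
      ← Complex.ofReal_mul, Complex.re_mul_ofReal]
    ring
  rw [e] at h2
  refine h2.congr' ?_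
  filter_upwards [hpos] with β hβ
  simp only [Function.comp_apply]
  rw [T.integral_saddleIntegrand Q hφ hβ, Complex.ofReal_re]

end UnitaryU1CFT

/-! ### Bandlimited majorants and minorants of an interval. -/

/-- The Fourier transform of the even extension of a function on `[0, Λ]`. -/
def cosTransform (Λ : ℝ) (ψ : ℝ → ℝ) (x : ℝ) : ℝ := 2 * ∫ t in (0 : ℝ)..Λ, ψ t * Real.cos (x * t)

theorem abs_cosTransform_le {Λ : ℝ} (hΛ : 0 ≤ Λ) {ψ : ℝ → ℝ} (hψ : Continuous ψ) (x : ℝ) :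
    |cosTransform Λ ψ x| ≤ 2 * ∫ t in (0 : ℝ)..Λ, |ψ t| := by
  rw [cosTransform, abs_mul, abs_two]
  gcongr
  refine (intervalIntegral.abs_integral_le_integral_abs hΛ).trans
    (intervalIntegral.integral_mono_on hΛ (Continuous.intervalIntegrable (by fun_prop) _ _)
      (Continuous.intervalIntegrable (by fun_prop) _ _) fun t _ => ?_)
  rw [abs_mul]
  exact mul_le_of_le_one_right (abs_nonneg _) (Real.abs_cos_le_one _)

theorem integral_even_extension {Λ : ℝ} (hΛ : 0 ≤ Λ) {ψ : ℝ → ℝ} (hψ : Continuous ψ)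
    (h0 : ψ Λ = 0) (x : ℝ) :
    ∫ t : ℝ, (ψ (min |t| Λ) : ℂ) * Complex.exp (-(Complex.I * t * x)) = cosTransform Λ ψ x := by
  set g : ℝ → ℂ := fun t => (ψ (min |t| Λ) : ℂ) * Complex.exp (-(Complex.I * t * x)) with hg
  have hgc : Continuous g := by simp only [hg]; fun_prop
  have h1 : ∫ t : ℝ, g t = ∫ t in (-Λ)..Λ, g t := by
    rw [intervalIntegral.integral_of_le (by linarith), ← integral_Icc_eq_integral_Ioc,
      setIntegral_eq_integral_of_forall_compl_eq_zero]
    intro t ht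
    have : Λ ≤ |t| := by
      by_contra hc
      exact ht (abs_le.mp (not_le.mp hc).le)
    simp [hg, min_eq_right this, h0]
  have h2 : ∫ t in (-Λ)..0, g t = ∫ t in (0 : ℝ)..Λ, g (-t) := by
    rw [intervalIntegral.integral_comp_neg, neg_zero]
  have hi : ∀ a b, IntervalIntegrable g volume a b := fun a b => hgc.intervalIntegrable a b
  have hi' : IntervalIntegrable (fun t => g (-t)) volume 0 Λ :=
    (hgc.comp continuous_neg).intervalIntegrable _ _
  rw [h1, ← intervalIntegral.integral_add_adjacent_intervals (hi _ 0) (hi _ _), h2,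
    ← intervalIntegral.integral_add hi' (hi _ _), cosTransform,
    ← intervalIntegral.integral_const_mul, ← intervalIntegral.integral_ofReal]
  refine intervalIntegral.integral_congr fun t ht => ?_
  rw [Set.uIcc_of_le hΛ] at ht
  simp only [hg, abs_neg, abs_of_nonneg ht.1, min_eq_left ht.2]
  push_cast
  rw [Complex.cos, ← mul_add]
  have e1 : -(Complex.I * -(t : ℂ) * x) = x * t * Complex.I := by ring
  have e2 : -(Complex.I * (t : ℂ) * x) = -(x * t) * Complex.I := by ring
  rw [e1, e2]; ring

-- Fourier inversion in the opposite direction: it certifies the band of a function constructed as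
-- the transform of a compactly supported `Φ`.
open scoped FourierTransform in
theorem bandFourier_of_eq_integral {Φ : ℝ → ℂ} (hΦc : Continuous Φ) (hΦ : Integrable Φ)
    {F : ℝ → ℝ} (hF : Integrable F)
    (h : ∀ x : ℝ, ∫ t : ℝ, Φ t * Complex.exp (-(Complex.I * t * x)) = F x) (t : ℝ) :
    bandFourier F t = Φ t := by
  have hpi := Real.pi_pos
  have h1 : ∀ y, 𝓕 Φ y = F (2 * Real.pi * y) := by
    intro y
    rw [Real.fourier_eq', ← h]
    congr 1
    ext t
    rw [smul_eq_mul, mul_comm]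
    congr 2
    simp only [RCLike.inner_apply, conj_trivial]
    push_cast; ring
  have hint : Integrable (𝓕 Φ) := by
    rw [funext h1]
    exact (hF.comp_mul_left' (R := 2 * Real.pi) (by positivity)).ofReal
  have h2 := congrFun (hΦc.fourierInv_fourier_eq hΦ hint) t
  rw [← h2, Real.fourierInv_eq', bandFourier]
  have h3 := Measure.integral_comp_mul_left
    (fun x : ℝ => (F x : ℂ) * Complex.exp (Complex.I * t * x)) (2 * Real.pi)
  rw [abs_of_pos (by positivity), Complex.real_smul] at h3
  have e : (((2 * Real.pi)⁻¹ : ℝ) : ℂ) = 1 / (2 * Real.pi) := by push_cast; rw [one_div, mul_inv]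
  rw [e] at h3
  rw [← h3]
  congr 1
  ext y
  rw [h1, smul_eq_mul, mul_comm]
  congr 2
  simp only [RCLike.inner_apply, conj_trivial]
  push_cast; ring

theorem integrable_of_continuous_of_le_div_sq {F : ℝ → ℝ} (hF : Continuous F) {M C R : ℝ}
    (hR : 0 < R) (hC : 0 ≤ C) (hM : ∀ x, |F x| ≤ M) (h : ∀ x, R ≤ |x| → |F x| ≤ C / x ^ 2) :
    Integrable F := by
  have hM0 : 0 ≤ M := (abs_nonneg _).trans (hM 0)
  refine Integrable.mono' (integrable_inv_one_add_sq.const_mul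
    (M * (1 + R ^ 2) + C * (1 + (R ^ 2)⁻¹))) hF.aestronglyMeasurable
    (Eventually.of_forall fun x => ?_)
  rw [Real.norm_eq_abs, ← div_eq_mul_inv, le_div_iff₀ (by positivity)]
  rcases le_total R |x| with hx | hx
  · have hx2 : R ^ 2 ≤ x ^ 2 := by rw [← sq_abs x]; gcongr
    have hx0 : 0 < x ^ 2 := lt_of_lt_of_le (by positivity) hx2
    have hx1 : x ≠ 0 := by rintro rfl; simp at hx0
    refine le_add_of_nonneg_of_le (by positivity) ?_
    calc _ ≤ C / x ^ 2 * (1 + x ^ 2) := by gcongr; exact h x hx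
      _ = C * (1 + (x ^ 2)⁻¹) := by field_simp; ring
      _ ≤ _ := by gcongr
  · have hx2 : x ^ 2 ≤ R ^ 2 := by rw [← sq_abs x]; gcongr
    refine le_add_of_le_of_nonneg ?_ (by positivity)
    gcongr
    exact hM x

theorem continuous_cosTransform (Λ : ℝ) {ψ : ℝ → ℝ} (hψ : Continuous ψ) :
    Continuous (cosTransform Λ ψ) :=
  continuous_const.mul (intervalIntegral.continuous_parametric_intervalIntegral_of_continuous'
    (f := fun x t => ψ t * Real.cos (x * t)) (by fun_prop) 0 Λ)

theorem bandFourier_const_mul (r : ℝ) (φ : ℝ → ℝ) (t : ℝ) :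
    bandFourier (fun x => r * φ x) t = r * bandFourier φ t := by
  simp only [bandFourier]
  rw [mul_left_comm, ← integral_const_mul (r : ℂ)]
  congr 2
  ext x
  push_cast; ring

/-- The cosine transform of a function on `[0, Λ]` vanishing at `Λ`, if integrable, is
bandlimited. -/
theorem isBandlimited_cosTransform {Λ : ℝ} (hΛ : 0 ≤ Λ) {ψ : ℝ → ℝ} (hψ : Continuous ψ)
    (h0 : ψ Λ = 0) (hint : Integrable (cosTransform Λ ψ)) (r : ℝ) :
    IsBandlimited Λ (fun x => r * cosTransform Λ ψ x) ∧
      bandFourier (fun x => r * cosTransform Λ ψ x) 0 = ((r * ψ 0 : ℝ) : ℂ) := by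
  have hΦc : Continuous fun t : ℝ => (ψ (min |t| Λ) : ℂ) := by fun_prop
  have hsupp : ∀ t : ℝ, Λ ≤ |t| → (ψ (min |t| Λ) : ℂ) = 0 := fun t ht => by
    simp [min_eq_right ht, h0]
  have hΦ : Integrable fun t : ℝ => (ψ (min |t| Λ) : ℂ) :=
    hΦc.integrable_of_hasCompactSupport (HasCompactSupport.intro
      (isCompact_Icc (a := -Λ) (b := Λ)) fun t ht => hsupp t (by
        by_contra hc
        exact ht (abs_le.mp (not_le.mp hc).le)))
  have key := bandFourier_of_eq_integral hΦc hΦ hint (integral_even_extension hΛ hψ h0)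
  refine ⟨⟨continuous_const.mul (continuous_cosTransform Λ hψ), hint.const_mul r,
    fun t ht => ?_⟩, ?_⟩
  · rw [bandFourier_const_mul, key, hsupp t ht.le, mul_zero]
  · rw [bandFourier_const_mul, key, abs_zero, min_eq_left hΛ]; push_cast; rfl

theorem integral_sub_mul_cos (Λ : ℝ) {y : ℝ} (hy : y ≠ 0) :
    ∫ t in (0 : ℝ)..Λ, (Λ - t) * Real.cos (y * t) = (1 - Real.cos (y * Λ)) / y ^ 2 := by
  rw [intervalIntegral.integral_eq_sub_of_hasDerivAt
    (f := fun t => (Λ - t) * (Real.sin (y * t) / y) - Real.cos (y * t) / y ^ 2) (fun t _ => ?_)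
    (Continuous.intervalIntegrable (by fun_prop) _ _)]
  · simp; ring
  · have h1 : HasDerivAt (fun t => y * t) y t := by simpa using (hasDerivAt_id t).const_mul y
    have h2 := ((((hasDerivAt_id t).const_sub Λ).mul (h1.sin.div_const y)).sub
      (h1.cos.div_const (y ^ 2)))
    exact h2.congr_deriv (by simp only [id]; field_simp; ring)

theorem integral_sin_const_mul (Λ : ℝ) {y : ℝ} (hy : y ≠ 0) :
    ∫ t in (0 : ℝ)..Λ, Real.sin (y * t) = (1 - Real.cos (y * Λ)) / y := by
  rw [intervalIntegral.integral_eq_sub_of_hasDerivAt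
    (f := fun t => - (Real.cos (y * t) / y)) (fun t _ => ?_)
    (Continuous.intervalIntegrable (by fun_prop) _ _)]
  · simp; ring
  · have h1 : HasDerivAt (fun t => y * t) y t := by simpa using (hasDerivAt_id t).const_mul y
    exact (h1.cos.div_const y).neg.congr_deriv (by field_simp)

/-- The Fejér kernel gives a nonnegative bandlimited majorant. -/
theorem exists_windowMajorant {δ : ℝ} (hδ : 1 / 2 < δ) : ∃ (Λ : ℝ) (φ : ℝ → ℝ),
    Λ < 2 * Real.pi ∧ IsWindowMajorant Λ δ φ ∧ 0 < windowConst δ φ := by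
  have hpi := Real.pi_gt_three
  have hδ0 : 0 < δ := by linarith
  -- Then `δΛ = 1 ≤ π`, so the quadratic bound on the cosine is valid on the window and keeps the
  -- kernel above `4Λ²/π²` there; and `Λ < 2 < 2π`.
  set Λ := 1 / δ with hΛ
  have hΛ0 : 0 < Λ := by positivity
  set ψ : ℝ → ℝ := fun t => Λ - t with hψ
  have hψc : Continuous ψ := by fun_prop
  have hval : ∀ x, x ≠ 0 → cosTransform Λ ψ x = 2 * ((1 - Real.cos (x * Λ)) / x ^ 2) :=
    fun x hx => by rw [cosTransform, integral_sub_mul_cos Λ hx]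
  have hzero : cosTransform Λ ψ 0 = Λ ^ 2 := by
    simp only [cosTransform, hψ, zero_mul, Real.cos_zero, mul_one]
    rw [intervalIntegral.integral_sub (by simp) (by simp)]
    simp; ring
  have hint : Integrable (cosTransform Λ ψ) := by
    refine integrable_of_continuous_of_le_div_sq (continuous_cosTransform Λ hψc) one_pos
      (C := 4) (by norm_num) (abs_cosTransform_le hΛ0.le hψc) fun x hx => ?_
    have hx0 : x ≠ 0 := by rintro rfl; norm_num at hx
    have h1 := Real.neg_one_le_cos (x * Λ)
    have h2 := Real.cos_le_one (x * Λ)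
    have : 0 < x ^ 2 := by positivity
    rw [hval x hx0, abs_of_nonneg (mul_nonneg (by norm_num) (div_nonneg (by linarith) this.le)),
      ← mul_div_assoc]
    gcongr
    linarith
  obtain ⟨hb, hb0⟩ := isBandlimited_cosTransform hΛ0.le hψc (by simp [hψ]) hint
    (Real.pi ^ 2 / (4 * Λ ^ 2))
  refine ⟨Λ, _, ?_, ⟨hb, fun x => ?_⟩, ?_⟩
  · rw [hΛ, div_lt_iff₀ hδ0]; nlinarith
  · by_cases hx : x ∈ Set.Icc (-δ) δ
    · rw [Set.indicator_of_mem hx]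
      have hle : 4 * Λ ^ 2 / Real.pi ^ 2 ≤ cosTransform Λ ψ x := by
        by_cases hx0 : x = 0
        · rw [hx0, hzero, div_le_iff₀ (by positivity)]
          nlinarith [mul_nonneg (sq_nonneg Λ) (show 0 ≤ Real.pi ^ 2 - 4 by nlinarith)]
        · have hθ : |x * Λ| ≤ Real.pi := by
            rw [abs_mul, abs_of_pos hΛ0]
            have : |x| * Λ ≤ δ * Λ := by gcongr; exact abs_le.mpr hx
            have h1 : δ * Λ = 1 := by rw [hΛ]; field_simp
            linarith
          have h2 := Real.cos_le_one_sub_mul_cos_sq hθ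
          have hx2 : 0 < x ^ 2 := by positivity
          rw [hval x hx0, ← mul_div_assoc, le_div_iff₀ hx2]
          calc _ = 2 * (2 / Real.pi ^ 2 * (x * Λ) ^ 2) := by ring
            _ ≤ _ := by linarith
      calc (1 : ℝ) = Real.pi ^ 2 / (4 * Λ ^ 2) * (4 * Λ ^ 2 / Real.pi ^ 2) := by field_simp
        _ ≤ _ := by gcongr
    · rw [Set.indicator_of_notMem hx]
      refine mul_nonneg (by positivity) ?_
      by_cases hx0 : x = 0
      · rw [hx0, hzero]; positivity
      · have h2 := Real.cos_le_one (x * Λ)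
        rw [hval x hx0]
        exact mul_nonneg (by norm_num) (div_nonneg (by linarith) (sq_nonneg x))
  · rw [windowConst, hb0, Complex.ofReal_re]
    simp only [hψ, sub_zero]
    positivity

/-- Partial fractions of `(δ² - x²)/(x² - a²)²`: the double poles at `±a` come from `(Λ - t)cos(at)`
and the simple poles from `sin(at)`. Since `aΛ = π`, all four integrals share the numerator `1 +
cos(xΛ)`, whose double zeros at `±a` cancel the poles. -/
theorem cosTransform_minorant {δ a Λ : ℝ} (ha : 0 < a) (haΛ : a * Λ = Real.pi) {x : ℝ}
    (h1 : x + a ≠ 0) (h2 : x - a ≠ 0) :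
    cosTransform Λ (fun t => (δ ^ 2 / a ^ 2 - 1) / 2 * ((Λ - t) * Real.cos (a * t)) +
        (δ ^ 2 / a ^ 2 + 1) / (2 * a) * Real.sin (a * t)) x =
      2 * (1 + Real.cos (x * Λ)) * (δ ^ 2 - x ^ 2) / (x ^ 2 - a ^ 2) ^ 2 := by
  have e : ∀ t, ((δ ^ 2 / a ^ 2 - 1) / 2 * ((Λ - t) * Real.cos (a * t)) +
        (δ ^ 2 / a ^ 2 + 1) / (2 * a) * Real.sin (a * t)) * Real.cos (x * t) =
      (δ ^ 2 / a ^ 2 - 1) / 4 * ((Λ - t) * Real.cos ((x + a) * t) +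
        (Λ - t) * Real.cos ((x - a) * t)) +
      (δ ^ 2 / a ^ 2 + 1) / (4 * a) * (Real.sin ((x + a) * t) - Real.sin ((x - a) * t)) := by
    intro t
    rw [add_mul x, sub_mul x, Real.cos_add, Real.cos_sub, Real.sin_add, Real.sin_sub]
    field_simp; ring
  have hi : ∀ f : ℝ → ℝ, Continuous f → IntervalIntegrable f volume 0 Λ :=
    fun f hf => hf.intervalIntegrable _ _
  simp only [cosTransform, e]
  rw [intervalIntegral.integral_add (hi _ (by fun_prop)) (hi _ (by fun_prop)),
    intervalIntegral.integral_const_mul, intervalIntegral.integral_const_mul,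
    intervalIntegral.integral_add (hi _ (by fun_prop)) (hi _ (by fun_prop)),
    intervalIntegral.integral_sub (hi _ (by fun_prop)) (hi _ (by fun_prop)),
    integral_sub_mul_cos Λ h1, integral_sub_mul_cos Λ h2, integral_sin_const_mul Λ h1,
    integral_sin_const_mul Λ h2, add_mul, sub_mul, haΛ, Real.cos_add_pi, Real.cos_sub_pi]
  have h3 : x ^ 2 - a ^ 2 = (x + a) * (x - a) := by ring
  rw [h3]
  field_simp
  ring

/-- The extremal minorant, of positive integral as soon as the window is longer than `2π / Λ`. -/
theorem exists_windowMinorant {δ : ℝ} (hδ : 1 / 2 < δ) : ∃ (Λ : ℝ) (φ : ℝ → ℝ),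
    Λ < 2 * Real.pi ∧ IsWindowMinorant Λ δ φ ∧ 0 < windowConst δ φ := by
  have hpi := Real.pi_pos
  have hδ0 : 0 < δ := by linarith
  -- `a > 1/2` gives `Λ = π/a < 2π`, and `a < δ` makes the transform at zero, `Λ(δ²/a² - 1)/2`,
  -- positive.
  obtain ⟨a, ha, haδ⟩ := exists_between hδ
  have ha0 : 0 < a := by linarith
  set Λ := Real.pi / a with hΛ
  have hΛ0 : 0 < Λ := by positivity
  have haΛ : a * Λ = Real.pi := by rw [hΛ]; field_simp
  set ψ : ℝ → ℝ := fun t => (δ ^ 2 / a ^ 2 - 1) / 2 * ((Λ - t) * Real.cos (a * t)) +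
        (δ ^ 2 / a ^ 2 + 1) / (2 * a) * Real.sin (a * t) with hψ
  have hψc : Continuous ψ := by fun_prop
  have hval : ∀ x, δ ≤ |x| → cosTransform Λ ψ x =
      2 * (1 + Real.cos (x * Λ)) * (δ ^ 2 - x ^ 2) / (x ^ 2 - a ^ 2) ^ 2 := fun x hx => by
    refine cosTransform_minorant ha0 haΛ (fun h => ?_) (fun h => ?_)
    · rw [show x = -a by linarith, abs_neg, abs_of_pos ha0] at hx; linarith
    · rw [show x = a by linarith, abs_of_pos ha0] at hx; linarith
  have hint : Integrable (cosTransform Λ ψ) := by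
    refine integrable_of_continuous_of_le_div_sq (continuous_cosTransform Λ hψc)
      (R := 2 * δ) (by positivity) (C := 8) (by norm_num) (abs_cosTransform_le hΛ0.le hψc)
      fun x hx => ?_
    have h1 := Real.neg_one_le_cos (x * Λ)
    have h2 := Real.cos_le_one (x * Λ)
    have hx2 : (2 * δ) ^ 2 ≤ x ^ 2 := by rw [← sq_abs x]; gcongr
    have had : a ^ 2 ≤ δ ^ 2 := by gcongr
    have hδ2 : 0 < δ ^ 2 := by positivity
    have hx0 : 0 < x ^ 2 := by nlinarith
    have hp : x ^ 2 / 2 ≤ x ^ 2 - a ^ 2 := by nlinarith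
    have hp0 : 0 < x ^ 2 - a ^ 2 := by linarith
    rw [hval x (by linarith), abs_div, abs_mul, abs_of_nonneg (show 0 ≤ 2 * (1 + Real.cos (x * Λ)) by
      linarith), abs_of_nonpos (show δ ^ 2 - x ^ 2 ≤ 0 by nlinarith), abs_of_pos (by positivity)]
    calc _ ≤ 4 * (x ^ 2 - a ^ 2) / (x ^ 2 - a ^ 2) ^ 2 := by
          gcongr
          · linarith
          · linarith
          · linarith
      _ = 4 / (x ^ 2 - a ^ 2) := by field_simp
      _ ≤ 4 / (x ^ 2 / 2) := by gcongr
      _ = _ := by field_simp; norm_num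
  -- Outside the window the factor `δ² - x²` already makes the function nonpositive, so dividing by
  -- a global bound is enough to make it a minorant. The added 1 keeps `M` positive.
  set M := (2 * ∫ t in (0 : ℝ)..Λ, |ψ t|) + 1 with hM
  have hMb : ∀ x, |cosTransform Λ ψ x| ≤ M := fun x =>
    (abs_cosTransform_le hΛ0.le hψc x).trans (by linarith)
  have hM0 : 0 < M := by
    have : 0 ≤ ∫ t in (0 : ℝ)..Λ, |ψ t| :=
      intervalIntegral.integral_nonneg hΛ0.le fun _ _ => abs_nonneg _
    linarith
  obtain ⟨hb, hb0⟩ := isBandlimited_cosTransform hΛ0.le hψc (by simp [hψ, haΛ]) hint M⁻¹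
  refine ⟨Λ, _, ?_, ⟨hb, fun x => ?_⟩, ?_⟩
  · rw [hΛ, div_lt_iff₀ ha0]; nlinarith
  · by_cases hx : x ∈ Set.Icc (-δ) δ
    · rw [Set.indicator_of_mem hx, inv_mul_le_iff₀ hM0, mul_one]
      exact (le_abs_self _).trans (hMb x)
    · rw [Set.indicator_of_notMem hx]
      have hx1 : δ ≤ |x| := by
        by_contra hc
        exact hx (abs_le.mp (not_le.mp hc).le)
      have hx2 : δ ^ 2 ≤ x ^ 2 := by rw [← sq_abs x]; gcongr
      have h1 := Real.neg_one_le_cos (x * Λ)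
      rw [hval x hx1]
      refine mul_nonpos_of_nonneg_of_nonpos (by positivity)
        (div_nonpos_of_nonpos_of_nonneg ?_ (sq_nonneg _))
      exact mul_nonpos_of_nonneg_of_nonpos (by linarith) (by linarith)
  · rw [windowConst, hb0, Complex.ofReal_re]
    have : 0 < δ ^ 2 / a ^ 2 - 1 := by
      rw [sub_pos, one_lt_div (by positivity)]; gcongr
    simp only [hψ, sub_zero, mul_zero, Real.cos_zero, Real.sin_zero, mul_one, add_zero]
    positivity

/-! ### From smoothed sums to counting states. -/

theorem IsBandlimited.abs_le {Λ : ℝ} {φ : ℝ → ℝ} (h : IsBandlimited Λ φ) (x : ℝ) :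
    |φ x| ≤ ∫ t : ℝ, ‖bandFourier φ t‖ := by
  rw [← Real.norm_eq_abs, ← Complex.norm_real, ← h.inversion x]
  refine (norm_integral_le_integral_norm _).trans_eq (integral_congr_ae
    (Eventually.of_forall fun t => ?_))
  simp only
  rw [norm_mul, Complex.norm_exp]
  simp

namespace UnitaryU1CFT

variable {H : Type*} [NormedAddCommGroup H] [InnerProductSpace ℂ H] {ι : Type*}

theorem finite_window (T : UnitaryU1CFT H ι) (Q : ℤ) (δ Δ : ℝ) :
    {i | T.charge i = Q ∧ T.dim i ∈ Set.Icc (Δ - δ) (Δ + δ)}.Finite :=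
  (T.finite_dim_le (Δ + δ)).subset fun _ hi => hi.2.2

open Classical in
theorem summable_windowSum (T : UnitaryU1CFT H ι) (Q : ℤ) {Λ : ℝ} {φ : ℝ → ℝ}
    (hφ : IsBandlimited Λ φ) {β : ℝ} (hβ : 0 < β) (Δ : ℝ) :
    Summable fun i => if T.charge i = Q then Real.exp (-β * T.dim i) * φ (T.dim i - Δ) else 0 := by
  refine Summable.of_norm_bounded ((T.summable_exp_dim hβ).mul_right
    (∫ t : ℝ, ‖bandFourier φ t‖)) fun i => ?_
  split_ifs
  · rw [norm_mul, Real.norm_of_nonneg (Real.exp_pos _).le]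
    gcongr
    exact hφ.abs_le _
  · rw [norm_zero]
    exact mul_nonneg (Real.exp_pos _).le (integral_nonneg fun _ => norm_nonneg _)

theorem sub_mem_window {d Δ δ : ℝ} : d - Δ ∈ Set.Icc (-δ) δ ↔ d ∈ Set.Icc (Δ - δ) (Δ + δ) := by
  simp only [Set.mem_Icc]
  constructor <;> rintro ⟨h1, h2⟩ <;> constructor <;> linarith

/-- On the window `Δ' ≥ Δ - δ`, so `e^{β(Δ-δ)}e^{-βΔ'} ≤ 1`; off it the minorant is nonpositive. -/
theorem windowSum_le_ncard (T : UnitaryU1CFT H ι) (Q : ℤ) {Λ δ : ℝ} {φ : ℝ → ℝ}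
    (hφ : IsWindowMinorant Λ δ φ) {β : ℝ} (hβ : 0 < β) (Δ : ℝ) :
    Real.exp (β * (Δ - δ)) * T.windowSum Q φ β Δ ≤
      ({i | T.charge i = Q ∧ T.dim i ∈ Set.Icc (Δ - δ) (Δ + δ)}.ncard : ℝ) := by
  classical
  have hfin := T.finite_window Q δ Δ
  rw [Set.ncard_eq_toFinset_card _ hfin, Finset.card_eq_sum_ones, Nat.cast_sum, windowSum,
    ← tsum_mul_left]
  have h1 : ∑ i ∈ hfin.toFinset, ((1 : ℕ) : ℝ) =
      ∑' i, if i ∈ hfin.toFinset then (1 : ℝ) else 0 := by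
    rw [tsum_eq_sum (s := hfin.toFinset) fun i hi => if_neg hi]
    exact Finset.sum_congr rfl fun i hi => by rw [if_pos hi, Nat.cast_one]
  rw [h1]
  refine ((T.summable_windowSum Q hφ.1 hβ Δ).mul_left _).tsum_le_tsum (fun i => ?_)
    (summable_of_ne_finset_zero (s := hfin.toFinset) fun i hi => if_neg hi)
  have hi := hφ.2 (T.dim i - Δ)
  simp only [Set.Finite.mem_toFinset, Set.mem_ofPred_eq]
  by_cases hq : T.charge i = Q
  · rw [if_pos hq]
    by_cases hd : T.dim i ∈ Set.Icc (Δ - δ) (Δ + δ)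
    · rw [if_pos ⟨hq, hd⟩]
      rw [Set.indicator_of_mem (sub_mem_window.mpr hd)] at hi
      rw [← mul_assoc, ← Real.exp_add]
      calc _ ≤ Real.exp (β * (Δ - δ) + -β * T.dim i) * 1 := by gcongr
        _ ≤ 1 := by
          rw [mul_one, Real.exp_le_one_iff]
          nlinarith [hd.1]
    · rw [if_neg (fun h => hd h.2)]
      rw [Set.indicator_of_notMem (fun h => hd (sub_mem_window.mp h))] at hi
      exact mul_nonpos_of_nonneg_of_nonpos (Real.exp_pos _).le
        (mul_nonpos_of_nonneg_of_nonpos (Real.exp_pos _).le hi)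
  · rw [if_neg hq, if_neg (fun h => hq h.1), mul_zero]

/-- On the window `Δ' ≤ Δ + δ`, so `e^{β(Δ+δ)}e^{-βΔ'} ≥ 1`; off it the majorant contributes
nonnegatively. -/
theorem ncard_le_windowSum (T : UnitaryU1CFT H ι) (Q : ℤ) {Λ δ : ℝ} {φ : ℝ → ℝ}
    (hφ : IsWindowMajorant Λ δ φ) {β : ℝ} (hβ : 0 < β) (Δ : ℝ) :
    ({i | T.charge i = Q ∧ T.dim i ∈ Set.Icc (Δ - δ) (Δ + δ)}.ncard : ℝ) ≤
      Real.exp (β * (Δ + δ)) * T.windowSum Q φ β Δ := by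
  classical
  have hfin := T.finite_window Q δ Δ
  rw [Set.ncard_eq_toFinset_card _ hfin, Finset.card_eq_sum_ones, Nat.cast_sum, windowSum,
    ← tsum_mul_left]
  have hφ0 : ∀ x, 0 ≤ φ x := fun x =>
    (Set.indicator_nonneg (fun _ _ => zero_le_one) x).trans (hφ.2 x)
  refine le_trans (Finset.sum_le_sum fun i hi => ?_)
    (((T.summable_windowSum Q hφ.1 hβ Δ).mul_left _).sum_le_tsum hfin.toFinset fun i _ => ?_)
  · obtain ⟨hq, hd⟩ := hfin.mem_toFinset.mp hi
    have h1 := hφ.2 (T.dim i - Δ)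
    rw [Set.indicator_of_mem (sub_mem_window.mpr hd)] at h1
    rw [if_pos hq, Nat.cast_one, ← mul_assoc, ← Real.exp_add]
    refine one_le_mul_of_one_le_of_one_le (Real.one_le_exp ?_) h1
    nlinarith [hd.2]
  · refine mul_nonneg (Real.exp_pos _).le ?_
    split_ifs
    · exact mul_nonneg (Real.exp_pos _).le (hφ0 _)
    · exact le_rfl

theorem cardyU1_pos (T : UnitaryU1CFT H ι) {Δ : ℝ} (hΔ : 0 < Δ) : 0 < T.cardyU1 Δ := by
  have := T.c_pos
  have := T.k_pos
  unfold cardyU1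
  positivity

theorem cardyU1_saddle (T : UnitaryU1CFT H ι) {β : ℝ} (hβ : 0 < β) :
    T.cardyU1 (Real.pi ^ 2 * T.c / 3 / β ^ 2) = √(3 / (T.k * T.c)) / (4 * Real.pi ^ 2) * (β ^ 2 *
      (Real.exp (Real.pi ^ 2 * T.c / 3 / β) * Real.exp (Real.pi ^ 2 * T.c / 3 / β))) := by
  have hc := T.c_pos
  have hk := T.k_pos
  have hpi := Real.pi_pos
  have e1 : √(T.c / (48 * T.k * (Real.pi ^ 2 * T.c / 3 / β ^ 2) ^ 2)) =
      √(3 / (T.k * T.c)) / (4 * Real.pi ^ 2) * β ^ 2 := by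
    rw [show T.c / (48 * T.k * (Real.pi ^ 2 * T.c / 3 / β ^ 2) ^ 2) =
      3 / (T.k * T.c) * (β ^ 2 / (4 * Real.pi ^ 2)) ^ 2 by field_simp; norm_num,
      Real.sqrt_mul (by positivity), Real.sqrt_sq (by positivity)]
    ring
  have e2 : √(T.c * (Real.pi ^ 2 * T.c / 3 / β ^ 2) / 3) = Real.pi * T.c / (3 * β) := by
    rw [show T.c * (Real.pi ^ 2 * T.c / 3 / β ^ 2) / 3 = (Real.pi * T.c / (3 * β)) ^ 2 by
      field_simp, Real.sqrt_sq (by positivity)]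
  rw [cardyU1, e1, e2, ← Real.exp_add, mul_assoc]
  congr 3
  field_simp; ring

/-- The ratio of a smoothed count to the Cardy density, with an edge factor `e^{sβ}`. -/
theorem tendsto_windowSum_div_cardyU1 {T : UnitaryU1CFT H ι} (hF : T.IsFaithfulCompact)
    (hT : T.IsModularCovariant) (Q : ℤ) (hN : T.leadingCoeff Q = 1) {Λ : ℝ}
    (hΛ : Λ < 2 * Real.pi) {φ : ℝ → ℝ} (hφ : IsBandlimited Λ φ) {δ : ℝ} (hδ : 0 < δ) (s : ℝ) :
    ∃ β : ℝ → ℝ, (∀ Δ, 0 < Δ → 0 < β Δ) ∧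
      Tendsto (fun Δ => 1 / (2 * δ) * (Real.exp (β Δ * (Δ + s)) * T.windowSum Q φ (β Δ) Δ) /
        T.cardyU1 Δ) atTop (𝓝 (windowConst δ φ)) := by
  have hc := T.c_pos
  have hk := T.k_pos
  have hpi := Real.pi_pos
  set A := Real.pi ^ 2 * T.c / 3 with hA
  have hA0 : 0 < A := by positivity
  -- The saddle temperature, the solution of `Δ = A/β²`. It tends to zero, so the edge factor
  -- `e^{sβ}` tends to 1, while `e^{βΔ} = e^{A/β}`.
  set β : ℝ → ℝ := fun Δ => √(A / Δ)
  have hβ0 : ∀ Δ, 0 < Δ → 0 < β Δ := fun Δ hΔ => Real.sqrt_pos.mpr (by positivity)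
  have hlim : Tendsto β atTop (𝓝[>] 0) := by
    refine tendsto_nhdsWithin_iff.mpr ⟨?_, ?_⟩
    · have := (Real.continuous_sqrt.tendsto 0).comp (tendsto_const_nhds (x := A) |>.div_atTop
        tendsto_id)
      rw [Real.sqrt_zero] at this
      exact this
    · filter_upwards [eventually_gt_atTop 0] with Δ hΔ using hβ0 Δ hΔ
  refine ⟨β, hβ0, ?_⟩
  have h1 := (tendsto_windowSum hF hT Q hN hΛ hφ).comp hlim
  have h2 : Tendsto (fun Δ => Real.exp (β Δ * s)) atTop (𝓝 1) := by
    have : Continuous fun b : ℝ => Real.exp (b * s) := by fun_prop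
    have := ((this.tendsto 0).mono_left nhdsWithin_le_nhds).comp hlim
    rwa [zero_mul, Real.exp_zero] at this
  have hs : 0 < √(3 / (T.k * T.c)) := Real.sqrt_pos.mpr (by positivity)
  have h3 := (h2.mul h1).const_mul (1 / (2 * δ) * (4 * Real.pi ^ 2 / √(3 / (T.k * T.c))))
  have e : 1 / (2 * δ) * (4 * Real.pi ^ 2 / √(3 / (T.k * T.c))) *
      (1 * ((bandFourier φ 0).re * (√(3 / (T.k * T.c)) / (2 * Real.pi)))) = windowConst δ φ := by
    rw [windowConst]; field_simp; norm_num
  rw [e] at h3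
  refine h3.congr' ?_
  filter_upwards [eventually_gt_atTop 0] with Δ hΔ
  have hb := hβ0 Δ hΔ
  have hΔβ : A / β Δ ^ 2 = Δ := by
    have : β Δ ^ 2 = A / Δ := Real.sq_sqrt (by positivity)
    rw [this]; field_simp
  simp only [Function.comp_apply]
  have hcd := T.cardyU1_saddle hb
  rw [← hA, hΔβ] at hcd
  rw [hcd, ← hA, hΔβ, Real.exp_neg, mul_add, Real.exp_add]
  have hE : β Δ * Δ = A / β Δ := by
    rw [← hΔβ, hΔβ]
    nth_rewrite 2 [← hΔβ]
    field_simp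
  rw [hE]
  have := Real.exp_pos (A / β Δ)
  field_simp

theorem eventually_mul_cardyU1_le_avgDensity {T : UnitaryU1CFT H ι} (hF : T.IsFaithfulCompact)
    (hT : T.IsModularCovariant) {Q : ℤ} (hN : T.leadingCoeff Q = 1) {δ : ℝ} (hδ : 0 < δ) {Λ : ℝ}
    (hΛ : Λ < 2 * Real.pi) {φ : ℝ → ℝ} (hφ : IsWindowMinorant Λ δ φ) {a : ℝ}
    (ha : a < windowConst δ φ) : ∀ᶠ Δ : ℝ in atTop, a * T.cardyU1 Δ ≤ T.avgDensity Q δ Δ := by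
  obtain ⟨β, hβ, h⟩ := tendsto_windowSum_div_cardyU1 hF hT Q hN hΛ hφ.1 hδ (-δ)
  filter_upwards [h.eventually (lt_mem_nhds ha), eventually_gt_atTop 0] with Δ h1 hΔ
  rw [lt_div_iff₀ (T.cardyU1_pos hΔ)] at h1
  refine h1.le.trans ?_
  rw [avgDensity]
  gcongr
  exact T.windowSum_le_ncard Q hφ (hβ Δ hΔ) Δ

theorem eventually_avgDensity_le_mul_cardyU1 {T : UnitaryU1CFT H ι} (hF : T.IsFaithfulCompact)
    (hT : T.IsModularCovariant) {Q : ℤ} (hN : T.leadingCoeff Q = 1) {δ : ℝ} (hδ : 0 < δ) {Λ : ℝ}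
    (hΛ : Λ < 2 * Real.pi) {φ : ℝ → ℝ} (hφ : IsWindowMajorant Λ δ φ) {a : ℝ}
    (ha : windowConst δ φ < a) : ∀ᶠ Δ : ℝ in atTop, T.avgDensity Q δ Δ ≤ a * T.cardyU1 Δ := by
  obtain ⟨β, hβ, h⟩ := tendsto_windowSum_div_cardyU1 hF hT Q hN hΛ hφ.1 hδ δ
  filter_upwards [h.eventually (gt_mem_nhds ha), eventually_gt_atTop 0] with Δ h1 hΔ
  rw [div_lt_iff₀ (T.cardyU1_pos hΔ)] at h1
  refine le_trans ?_ h1.le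
  rw [avgDensity]
  gcongr
  exact T.ncard_le_windowSum Q hφ (hβ Δ hΔ) Δ

end UnitaryU1CFT

theorem IsWindowMinorant.mono {Λ Λ' δ : ℝ} {φ : ℝ → ℝ} (h : IsWindowMinorant Λ δ φ)
    (hΛ : Λ ≤ Λ') : IsWindowMinorant Λ' δ φ := ⟨h.1.mono hΛ, h.2⟩

theorem IsWindowMajorant.mono {Λ Λ' δ : ℝ} {φ : ℝ → ℝ} (h : IsWindowMajorant Λ δ φ)
    (hΛ : Λ ≤ Λ') : IsWindowMajorant Λ' δ φ := ⟨h.1.mono hΛ, h.2⟩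

end

theorem mainTheorem5 :
    -- the bounds with `c_± = (2π / 2δ) φ̂_±(0)`, at leading order as `Δ → ∞`
    (∀ (H : Type*) [NormedAddCommGroup H] [InnerProductSpace ℂ H] (ι : Type*)
        (T : UnitaryU1CFT H ι) (Q : ℤ),
        T.IsFaithfulCompact → T.IsModularCovariant → T.leadingCoeff Q = 1 →
        ∀ δ : ℝ, 0 < δ → ∀ Λ : ℝ, Λ < 2 * Real.pi → ∀ φ : ℝ → ℝ,
          (IsWindowMinorant Λ δ φ → ∀ a : ℝ, a < windowConst δ φ →
            ∀ᶠ Δ : ℝ in atTop, a * T.cardyU1 Δ ≤ T.avgDensity Q δ Δ) ∧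
          (IsWindowMajorant Λ δ φ → ∀ a : ℝ, windowConst δ φ < a →
            ∀ᶠ Δ : ℝ in atTop, T.avgDensity Q δ Δ ≤ a * T.cardyU1 Δ)) ∧
    -- for `δ > 1/2` the two numbers `c_±` can be taken positive
    (∀ δ : ℝ, 1 / 2 < δ → ∃ (Λ : ℝ) (φm φp : ℝ → ℝ), Λ < 2 * Real.pi ∧
        IsWindowMinorant Λ δ φm ∧ IsWindowMajorant Λ δ φp ∧
        0 < windowConst δ φm ∧ 0 < windowConst δ φp) ∧
    -- so both bounds hold for all large `Δ`, with positive constants that depend on `δ` only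
    (∀ δ : ℝ, 1 / 2 < δ → ∃ cm cp : ℝ, 0 < cm ∧ 0 < cp ∧
      ∀ (H : Type*) [NormedAddCommGroup H] [InnerProductSpace ℂ H] (ι : Type*)
        (T : UnitaryU1CFT H ι) (Q : ℤ),
        T.IsFaithfulCompact → T.IsModularCovariant → T.leadingCoeff Q = 1 →
        ∀ᶠ Δ : ℝ in atTop, cm * T.cardyU1 Δ ≤ T.avgDensity Q δ Δ ∧
          T.avgDensity Q δ Δ ≤ cp * T.cardyU1 Δ) := by
  refine ⟨fun H _ _ ι T Q hF hT hN δ hδ Λ hΛ φ => ⟨fun hφ a ha => ?_, fun hφ a ha => ?_⟩,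
    fun δ hδ => ?_, fun δ hδ => ?_⟩
  · exact UnitaryU1CFT.eventually_mul_cardyU1_le_avgDensity hF hT hN hδ hΛ hφ ha
  · exact UnitaryU1CFT.eventually_avgDensity_le_mul_cardyU1 hF hT hN hδ hΛ hφ ha
  · obtain ⟨Λm, φm, hΛm, hm, hm0⟩ := exists_windowMinorant hδ
    obtain ⟨Λp, φp, hΛp, hp, hp0⟩ := exists_windowMajorant hδ
    exact ⟨max Λm Λp, φm, φp, max_lt hΛm hΛp, hm.mono (le_max_left _ _),
      hp.mono (le_max_right _ _), hm0, hp0⟩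
  · obtain ⟨Λm, φm, hΛm, hm, hm0⟩ := exists_windowMinorant hδ
    obtain ⟨Λp, φp, hΛp, hp, hp0⟩ := exists_windowMajorant hδ
    have hδ0 : 0 < δ := by linarith
    -- The extremal functions depend on `δ` only, hence so do these constants; the factors of 2 give
    -- the strict room required by the asymptotic bounds.
    refine ⟨windowConst δ φm / 2, 2 * windowConst δ φp, by positivity, by positivity,
      fun H _ _ ι T Q hF hT hN => ?_⟩
    filter_upwards [UnitaryU1CFT.eventually_mul_cardyU1_le_avgDensity hF hT hN hδ0 hΛm hm
      (half_lt_self hm0), UnitaryU1CFT.eventually_avgDensity_le_mul_cardyU1 hF hT hN hδ0 hΛp hp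
      (show windowConst δ φp < 2 * windowConst δ φp by linarith)] with Δ h1 h2
    exact ⟨h1, h2⟩
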